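/- Let $p\ge 1$ be an integer, let $V:\mathbb Z\to\mathbb R$ be $p$-periodic, and let $\Sigma=\sigma(H)\subset\mathbb R$ be the spectrum of the discrete Schrödinger operator $(Hu)(n)=u(n-1)+u(n+1)+V(n)u(n)$ on $\ell^2(\mathbb Z)$. Let $$\Delta(z)=\operatorname{tr}\left(\begin{bmatrix} z-V(p)&-1\\1&0\end{bmatrix}\cdots\begin{bmatrix} z-V(1)&-1\\1&0\end{bmatrix}\right)$$ be its discriminant. With $\mathbb C_+=\{z:\operatorname{Im}z>0\}$, there is an analytic map $\Theta:\mathbb C_+\to\mathbb C_+$ (the Marchenko–Ostrovski map) with $\operatorname{Re}\Theta\in[-\pi,0]$ and $\Delta(z)=2\cos(p\,\Theta(z))$ for all $z\in\mathbb C_+$. For every such $\Theta$, taking boundary values on $\mathbb R$ and Schwarz reflection extends $\Theta$ analytically through the interior $\mathring\Sigma$ of $\Sigma$, the extension is real on $\mathring\Sigma$, and, with the extension still denoted by $\Theta$: 1. $\Theta'(x)>0$ and $\Theta'''(x)>0$ for every $x\in\mathring\Sigma$. 2. Every connected component of $\Sigma$ is an interval $[a,b]$ with $a<b$, and $$\lim_{x\to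 a^+}\Theta''(x)=-\infty,\qquad \lim_{x\to b^-}\Theta''(x)=+\infty.$$ 3. In every connected component of $\mathring\Sigma$ the function $\Theta''$ has exactly one zero $x_*$, and $\Theta'''(x_*)\neq 0$. -/

import Mathlib

open Complex Set Filter Topology
open scoped lp Matrix ComplexConjugate

noncomputable section

namespace PeriodicSchrodinger

/-! ### The operator on square-summable sequences and its spectrum -/

theorem memℓp_shift (m : ℤ) (u : ℓ²(ℤ, ℂ)) : Memℓp (fun n : ℤ => u (n + m)) 2 := by
  have h := (lp.memℓp u).summable (by norm_num)
  exact memℓp_gen (h.comp_injective (add_left_injective m))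

/-- The translation `(S u)(n) = u (n + m)` as a bounded operator on `ℓ²(ℤ)`. -/
def shift (m : ℤ) : ℓ²(ℤ, ℂ) →L[ℂ] ℓ²(ℤ, ℂ) :=
  LinearMap.mkContinuous
    { toFun := fun u => ⟨fun n : ℤ => u (n + m), memℓp_shift m u⟩
      map_add' := fun _ _ => rfl
      map_smul' := fun _ _ => rfl }
    1 (by
      intro u
      rw [one_mul]
      refine lp.norm_le_of_tsum_le (by norm_num) (norm_nonneg _) ?_
      rw [lp.norm_rpow_eq_tsum (by norm_num) u]
      exact ((Equiv.addRight m).tsum_eq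
        (fun n : ℤ => ‖u n‖ ^ (2 : ENNReal).toReal)).le)

theorem norm_mul_le_ciSup {V : ℤ → ℝ} (hV : BddAbove (range fun n => |V n|)) (n : ℤ) :
    ‖(V n : ℂ) • ContinuousLinearMap.id ℂ ℂ‖ ≤ ⨆ k, |V k| := by
  rw [norm_smul, Complex.norm_real, Real.norm_eq_abs, ContinuousLinearMap.norm_id, mul_one]
  exact le_ciSup hV n

/-- Multiplication by a bounded real sequence, as a bounded operator on `ℓ²(ℤ)`. -/
def mulOperator (V : ℤ → ℝ) (hV : BddAbove (range fun n => |V n|)) :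
    ℓ²(ℤ, ℂ) →L[ℂ] ℓ²(ℤ, ℂ) :=
  lp.mapCLM 2 (fun n : ℤ => (V n : ℂ) • ContinuousLinearMap.id ℂ ℂ)
    (Real.iSup_nonneg fun n => abs_nonneg (V n)) (norm_mul_le_ciSup hV)

/-- The discrete Schrödinger operator `(H u)(n) = u (n - 1) + u (n + 1) + V n * u n`
on `ℓ²(ℤ)`. -/
def schrodingerOperator (V : ℤ → ℝ) (hV : BddAbove (range fun n => |V n|)) :
    ℓ²(ℤ, ℂ) →L[ℂ] ℓ²(ℤ, ℂ) :=
  shift (-1) + shift 1 + mulOperator V hV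

theorem schrodingerOperator_apply (V : ℤ → ℝ) (hV : BddAbove (range fun n => |V n|))
    (u : ℓ²(ℤ, ℂ)) (n : ℤ) :
    schrodingerOperator V hV u n = u (n - 1) + u (n + 1) + V n * u n := rfl

theorem bddAbove_of_periodic {V : ℤ → ℝ} {p : ℕ} (hp : 0 < p)
    (hV : Function.Periodic V (p : ℤ)) : BddAbove (range fun n => |V n|) := by
  have hfin : ((fun n => |V n|) '' Ico (0 : ℤ) (0 + p)).Finite := (finite_Ico _ _).image _
  refine hfin.bddAbove.mono ?_
  rintro _ ⟨n, rfl⟩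
  obtain ⟨m, hm, h⟩ := hV.exists_mem_Ico₀ (by exact_mod_cast hp) n
  exact ⟨m, by simpa using hm, by simp only [h]⟩

/-- The spectrum `Σ` of the `p`-periodic Schrödinger operator; the operator is bounded and
self-adjoint, so nothing is lost by recording only the real points of its spectrum. -/
def spectralSet {V : ℤ → ℝ} {p : ℕ} (hp : 0 < p) (hV : Function.Periodic V (p : ℤ)) : Set ℝ :=
  {x : ℝ | (x : ℂ) ∈ spectrum ℂ (schrodingerOperator V (bddAbove_of_periodic hp hV))}

/-! ### The discriminant and the Marchenko–Ostrovski map -/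

/-- The one-step transfer matrix. -/
def transferMatrix (V : ℤ → ℝ) (z : ℂ) (n : ℤ) : Matrix (Fin 2) (Fin 2) ℂ :=
  !![z - V n, -1; 1, 0]

/-- The ordered product `T(m) ⋯ T(1)` of transfer matrices; `m = p` is the monodromy matrix. -/
def monodromy (V : ℤ → ℝ) (z : ℂ) : ℕ → Matrix (Fin 2) (Fin 2) ℂ
  | 0 => 1
  | m + 1 => transferMatrix V z (m + 1) * monodromy V z m

/-- The Floquet discriminant. -/
def discriminant (V : ℤ → ℝ) (p : ℕ) (z : ℂ) : ℂ := (monodromy V z p).trace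

/-- The open upper half-plane. -/
def upperHalf : Set ℂ := {z : ℂ | 0 < z.im}

/-- `Θ` (a function of which only the values on the open upper half-plane are used) is the
Marchenko–Ostrovski map: an analytic self-map of the upper half-plane with real part in `[-π, 0]`
and `Δ = 2 cos (p Θ)`. -/
structure IsMarchenkoOstrovski (V : ℤ → ℝ) (p : ℕ) (Θ : ℂ → ℂ) : Prop where
  analytic : AnalyticOnNhd ℂ Θ upperHalf
  mapsTo : MapsTo Θ upperHalf upperHalf
  re_mem : ∀ z ∈ upperHalf, (Θ z).re ∈ Icc (-Real.pi) 0
  discriminant_eq : ∀ z ∈ upperHalf, discriminant V p z = 2 * Complex.cos (p * Θ z)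

/-- The extension of a function on the upper half-plane to `ℂ` by its boundary values on the real
line and by Schwarz reflection in the lower half-plane. -/
def schwarzExtension (Θ : ℂ → ℂ) (z : ℂ) : ℂ :=
  if 0 < z.im then Θ z
  else if z.im < 0 then conj (Θ (conj z))
  else limUnder (𝓝[upperHalf] z) Θ

/-- The extended map as a real function on the real line (on the interior of the spectrum
the extension is real, so there nothing is lost by taking the real part). -/
def boundaryValue (Θ : ℂ → ℂ) (x : ℝ) : ℝ := (schwarzExtension Θ x).re

end PeriodicSchrodinger

end

/-! The spectrum is identified with `{x : |Δ x| ≤ 2}`. One inclusion is the spectral mapping theorem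
applied to `Δ(H) = S^p + S^(-p)`, an operator of norm at most 2 (`aeval_discriminantPoly`). The
other truncates Floquet solutions with a unimodular multiplier (`mem_spectrum_of_bounded_solution`).

For `Im z > 0` there is a decaying Floquet solution `u` with multiplier `w`, `‖w‖ < 1`, and its
Wronskian with its own conjugate forces every ratio `u (n + 1) / u n` over one period into the lower
half-plane. Hence `Θ = -(i/p) ∑ log (u (n + 1) / u n)` is analytic, has real part in `[-π, 0]`, and
satisfies `exp (i p Θ) = w`, so `2 cos (p Θ) = w + 1/w = Δ`.

On the interior of the spectrum `4 - Δ²` is nonnegative and so is locally the square of a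
real-analytic germ, even at closed gaps. This gives a real-analytic local solution `G` of `2 cos G =
Δ`, and `p Θ` must equal `±G` plus a real constant (`exists_local_extension`).

Positivity is function theory of self-maps of the half-plane. A nonconstant germ, real on the line
and with nonnegative imaginary part above it, has positive derivative
(`IsRealAnalyticAt.deriv_pos`); this gives `Θ' > 0`. By Julia's lemma (`julia`) the regular part at
`x` of `-1 / (Θ - Θ x)` again has nonnegative imaginary part. Its derivative at `x` is the
Schwarzian of `Θ` divided by `6 Θ'`, so `Θ''' Θ' > (3/2) (Θ'')² ≥ 0`, unless that regular part is
constant; then `Θ''' > 0` could fail only for affine `Θ`, which bounded real part excludes.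

At a band edge, bounded `Θ''` would make `q = 4 - Δ² = 4 sin² (p Θ)` satisfy `q = q' = 0 < q''`
there, so `q` would have a local minimum and the edge would be interior. Since `Θ''` is increasing,
it must therefore diverge with the stated signs, and it has exactly one zero in each band. -/

noncomputable section

namespace PeriodicSchrodinger

/-! ### Transfer matrices over a commutative ring -/

section Transfer

variable {R : Type*} [CommRing R]

/-- The product of the transfer matrices at the sites `n + 1, …, n + m`. -/
def transferProduct (v : ℤ → R) (z : R) (n : ℤ) : ℕ → Matrix (Fin 2) (Fin 2) R
  | 0 => 1
  | m + 1 => !![z - v (n + m + 1), -1; 1, 0] * transferProduct v z n m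

theorem transferProduct_map {S : Type*} [CommRing S] (f : R →+* S) (v : ℤ → R) (z : R) (n : ℤ)
    (m : ℕ) :
    (transferProduct v z n m).map f = transferProduct (fun k => f (v k)) (f z) n m := by
  induction m with
  | zero => simp [transferProduct]
  | succ m ih =>
    rw [transferProduct, transferProduct, Matrix.map_mul, ih]
    congr 1
    ext i j
    fin_cases i <;> fin_cases j <;> simp

theorem det_transferProduct (v : ℤ → R) (z : R) (n : ℤ) (m : ℕ) :
    (transferProduct v z n m).det = 1 := by
  induction m with
  | zero => simp [transferProduct]
  | succ m ih => rw [transferProduct, Matrix.det_mul, ih, Matrix.det_fin_two_of]; ring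

theorem transferProduct_succ' (v : ℤ → R) (z : R) (n : ℤ) (m : ℕ) :
    transferProduct v z n (m + 1) =
      transferProduct v z (n + 1) m * !![z - v (n + 1), -1; 1, 0] := by
  induction m with
  | zero => simp [transferProduct]
  | succ m ih =>
    rw [transferProduct, ih, transferProduct, Matrix.mul_assoc]
    have : n + ((m + 1 : ℕ) : ℤ) + 1 = n + 1 + m + 1 := by push_cast; ring
    rw [this]

theorem transferProduct_add_period {v : ℤ → R} {p : ℕ} (hv : Function.Periodic v (p : ℤ)) (z : R)
    (n : ℤ) (m : ℕ) : transferProduct v z (n + p) m = transferProduct v z n m := by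
  induction m with
  | zero => rfl
  | succ m ih =>
    rw [transferProduct, transferProduct, ih]
    have : n + p + m + 1 = n + m + 1 + (p : ℤ) := by ring
    rw [this, hv]

/-- Moving the base point by one site conjugates the monodromy matrix by a single transfer matrix,
thanks to periodicity. -/
theorem trace_transferProduct_succ {v : ℤ → R} {p : ℕ} (hv : Function.Periodic v (p : ℤ)) (z : R)
    (n : ℤ) : (transferProduct v z (n + 1) p).trace = (transferProduct v z n p).trace := by
  set T : Matrix (Fin 2) (Fin 2) R := !![z - v (n + 1), -1; 1, 0] with hT
  set T' : Matrix (Fin 2) (Fin 2) R := !![0, 1; -1, z - v (n + 1)] with hT'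
  have h1 : T * T' = 1 := by
    ext i j
    fin_cases i <;> fin_cases j <;> simp [T, T', Matrix.mul_apply, Fin.sum_univ_two]
  have h2 : transferProduct v z (n + 1) p * T = T * transferProduct v z n p := by
    rw [← transferProduct_succ', transferProduct]
    have : n + p + 1 = n + 1 + (p : ℤ) := by ring
    rw [this, hv]
  calc (transferProduct v z (n + 1) p).trace
      = (transferProduct v z (n + 1) p * T * T').trace := by
        rw [Matrix.mul_assoc, h1, Matrix.mul_one]
    _ = (T' * T * transferProduct v z n p).trace := by
        rw [h2, Matrix.trace_mul_comm, Matrix.mul_assoc]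
    _ = (transferProduct v z n p).trace := by
        rw [mul_eq_one_comm.mp h1, Matrix.one_mul]

theorem trace_transferProduct {v : ℤ → R} {p : ℕ} (hv : Function.Periodic v (p : ℤ)) (z : R)
    (n : ℤ) : (transferProduct v z n p).trace = (transferProduct v z 0 p).trace := by
  induction n using Int.induction_on with
  | zero => rfl
  | succ n ih => rw [trace_transferProduct_succ hv, ih]
  | pred n ih => rw [← trace_transferProduct_succ hv, sub_add_cancel, ih]

variable {A : Type*} [AddCommGroup A]

/-- The intended `ε n` sends a polynomial `q` to the coordinate `(q(H) u)(n)`. The target is only an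
additive group, so the coefficients of the transfer matrix act inside the argument. -/
theorem apply_add_of_recurrence {v : ℤ → R} {z : R} {ε : ℤ → R →+ A}
    (hε : ∀ n q, ε (n + 1) q = ε n ((z - v n) * q) - ε (n - 1) q) (n : ℤ) (m : ℕ) (q : R) :
    ε (n + m + 1) q = ε (n + 1) (transferProduct v z n m 0 0 * q) +
        ε n (transferProduct v z n m 0 1 * q) ∧
      ε (n + m) q = ε (n + 1) (transferProduct v z n m 1 0 * q) +
        ε n (transferProduct v z n m 1 1 * q) := by
  induction m generalizing q with
  | zero => simp [transferProduct]
  | succ m ih =>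
    have e1 : n + ((m + 1 : ℕ) : ℤ) = n + m + 1 := by push_cast; ring
    rw [e1]
    refine ⟨?_, ?_⟩
    · rw [hε, add_sub_cancel_right, (ih _).1, (ih q).2]
      simp only [transferProduct, Matrix.mul_apply, Fin.sum_univ_two, Matrix.of_apply,
        Matrix.cons_val', Matrix.cons_val_zero, Matrix.cons_val_one, Matrix.cons_val_fin_one,
        add_mul, neg_mul, one_mul, map_add, map_neg]
      have a (x : R) : x * ((z - v (n + m + 1)) * q) = (z - v (n + m + 1)) * x * q := by ring
      rw [a, a]
      abel
    · rw [(ih q).1]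
      simp [transferProduct, Matrix.mul_apply, Fin.sum_univ_two]

/-- This is Cayley–Hamilton in the form `P + P⁻¹ = tr P` for a matrix of determinant 1: the same `P`
carries data from `n - p` to `n` and from `n` to `n + p`. -/
theorem add_apply_of_recurrence {v : ℤ → R} {p : ℕ} (hv : Function.Periodic v (p : ℤ)) {z : R}
    {ε : ℤ → R →+ A} (hε : ∀ n q, ε (n + 1) q = ε n ((z - v n) * q) - ε (n - 1) q) (n : ℤ)
    (q : R) :
    ε (n + p) q + ε (n - p) q = ε n ((transferProduct v z 0 p).trace * q) := by
  set P := transferProduct v z n p with hP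
  have hP' : transferProduct v z (n - p) p = P := by
    rw [hP, ← transferProduct_add_period hv z (n - p), sub_add_cancel]
  have hdet : P 0 0 * P 1 1 - P 0 1 * P 1 0 = 1 := by
    rw [← Matrix.det_fin_two, hP, det_transferProduct]
  have h1 := (apply_add_of_recurrence hε n p q).2
  have h2 := (apply_add_of_recurrence hε (n - p) p (P 1 0 * q)).1
  have h3 := (apply_add_of_recurrence hε (n - p) p (P 0 0 * q)).2
  rw [← hP] at h1
  rw [hP', sub_add_cancel] at h2 h3
  -- Inserting `det P = 1` produces the terms already present in `h2` and `h3`, so the data at `n -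
  -- p` and `n - p + 1` cancel.
  have h4 : ε (n - p) q = ε (n - p) (P 1 1 * (P 0 0 * q)) - ε (n - p) (P 0 1 * (P 1 0 * q)) := by
    rw [← map_sub]
    congr 1
    linear_combination -q * hdet
  have h5 : ε (n - p + 1) (P 1 0 * (P 0 0 * q)) = ε (n - p + 1) (P 0 0 * (P 1 0 * q)) := by
    congr 1
    ring
  rw [← trace_transferProduct hv z n, ← hP, Matrix.trace_fin_two, add_mul, map_add, h1, h2, h3,
    h4, h5]
  abel

end Transfer

theorem monodromy_eq_transferProduct (V : ℤ → ℝ) (z : ℂ) (m : ℕ) :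
    monodromy V z m = transferProduct (fun n => (V n : ℂ)) z 0 m := by
  induction m with
  | zero => rfl
  | succ m ih => rw [monodromy, transferProduct, ih, transferMatrix, zero_add]

theorem det_monodromy (V : ℤ → ℝ) (z : ℂ) (m : ℕ) : (monodromy V z m).det = 1 := by
  rw [monodromy_eq_transferProduct, det_transferProduct]

/-- The discriminant as a polynomial. -/
def discriminantPoly (V : ℤ → ℝ) (p : ℕ) : Polynomial ℂ :=
  (transferProduct (fun n => Polynomial.C (V n : ℂ)) Polynomial.X 0 p).trace

theorem eval_discriminantPoly (V : ℤ → ℝ) (p : ℕ) (z : ℂ) :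
    (discriminantPoly V p).eval z = discriminant V p z := by
  have h := transferProduct_map (Polynomial.evalRingHom z) (fun n => Polynomial.C (V n : ℂ))
    Polynomial.X 0 p
  rw [discriminant, monodromy_eq_transferProduct, discriminantPoly, Matrix.trace_fin_two,
    Matrix.trace_fin_two, Polynomial.eval_add]
  simp only [Polynomial.coe_evalRingHom, Polynomial.eval_C, Polynomial.eval_X] at h
  rw [← h]
  rfl

/-! ### The spectrum lies in the set where the discriminant is bounded by two -/

theorem norm_shift_le (m : ℤ) : ‖shift m‖ ≤ 1 :=
  LinearMap.mkContinuous_norm_le _ zero_le_one _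

/-- The coordinate `(q(H) u)(n)`, as an additive function of the polynomial `q`. -/
def aevalCoord (H : ℓ²(ℤ, ℂ) →L[ℂ] ℓ²(ℤ, ℂ)) (u : ℓ²(ℤ, ℂ)) (n : ℤ) : Polynomial ℂ →+ ℂ where
  toFun q := (Polynomial.aeval H q) u n
  map_zero' := by simp
  map_add' := by intros; simp

/-- With `z` replaced by the indeterminate, `H` itself solves the eigenvalue equation, so every
sequence `q(H) u` obeys the transfer recurrence over the polynomial ring. -/
theorem aeval_discriminantPoly {V : ℤ → ℝ} {p : ℕ} (hp : 0 < p)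
    (hV : Function.Periodic V (p : ℤ)) :
    Polynomial.aeval (schrodingerOperator V (bddAbove_of_periodic hp hV)) (discriminantPoly V p) =
      shift p + shift (-p) := by
  set H := schrodingerOperator V (bddAbove_of_periodic hp hV)
  ext u n
  have hrec : ∀ n q, aevalCoord H u (n + 1) q =
      aevalCoord H u n ((Polynomial.X - Polynomial.C (V n : ℂ)) * q) -
        aevalCoord H u (n - 1) q := by
    intro n q
    have : (Polynomial.aeval H) ((Polynomial.X - Polynomial.C (V n : ℂ)) * q) u n =
        H (Polynomial.aeval H q u) n - V n * (Polynomial.aeval H q u n) := by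
      rw [map_mul, map_sub, Polynomial.aeval_X, Polynomial.aeval_C,
        Algebra.algebraMap_eq_smul_one, sub_mul, smul_one_mul]
      rfl
    simp only [aevalCoord, AddMonoidHom.coe_mk, ZeroHom.coe_mk]
    rw [this, schrodingerOperator_apply]
    ring
  have hv : Function.Periodic (fun n => Polynomial.C (V n : ℂ)) (p : ℤ) := fun n => by
    simp only [hV n]
  have h := add_apply_of_recurrence hv hrec n 1
  simp only [aevalCoord, AddMonoidHom.coe_mk, ZeroHom.coe_mk, mul_one, map_one,
    one_apply_eq_self] at h
  rw [discriminantPoly, ← h]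
  rfl

theorem norm_discriminant_le_two {V : ℤ → ℝ} {p : ℕ} (hp : 0 < p)
    (hV : Function.Periodic V (p : ℤ)) {z : ℂ}
    (hz : z ∈ spectrum ℂ (schrodingerOperator V (bddAbove_of_periodic hp hV))) :
    ‖discriminant V p z‖ ≤ 2 := by
  have h := spectrum.subset_polynomial_aeval
    (schrodingerOperator V (bddAbove_of_periodic hp hV)) (discriminantPoly V p) ⟨z, hz, rfl⟩
  rw [aeval_discriminantPoly hp hV] at h
  simp only [eval_discriminantPoly] at h
  refine (spectrum.norm_le_norm_mul_of_mem h).trans ?_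
  refine (mul_le_of_le_one_right (norm_nonneg _) ContinuousLinearMap.norm_id_le).trans ?_
  refine (norm_add_le _ _).trans ?_
  linarith [norm_shift_le p, norm_shift_le (-p)]

/-! ### Solutions of the difference equation on the half-line -/

/-- The solution of `u (n + 1) + u (n - 1) + V n * u n = z * u n` on the half-line `0 ≤ n` with
`(u 1, u 0) = v`. -/
def halfLineSolution (V : ℤ → ℝ) (z : ℂ) (v : Fin 2 → ℂ) (n : ℕ) : ℂ := (monodromy V z n *ᵥ v) 1

section HalfLine

variable (V : ℤ → ℝ) (z : ℂ) (v : Fin 2 → ℂ)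

theorem halfLineSolution_zero : halfLineSolution V z v 0 = v 1 := by
  simp [halfLineSolution, monodromy]

theorem halfLineSolution_succ (n : ℕ) :
    halfLineSolution V z v (n + 1) = (monodromy V z n *ᵥ v) 0 := by
  rw [halfLineSolution, monodromy, ← Matrix.mulVec_mulVec]
  simp [transferMatrix, Matrix.mulVec, dotProduct, Fin.sum_univ_two]

theorem halfLineSolution_one : halfLineSolution V z v 1 = v 0 := by
  rw [halfLineSolution_succ]
  simp [monodromy]

theorem halfLineSolution_add_two (n : ℕ) :
    halfLineSolution V z v (n + 2) =
      (z - V (n + 1)) * halfLineSolution V z v (n + 1) - halfLineSolution V z v n := by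
  rw [halfLineSolution_succ, monodromy, ← Matrix.mulVec_mulVec, halfLineSolution_succ,
    halfLineSolution]
  simp [transferMatrix, Matrix.mulVec, dotProduct, Fin.sum_univ_two, sub_eq_add_neg]

variable {V z v}

theorem monodromy_add_period {p : ℕ} (hV : Function.Periodic V (p : ℤ)) (n : ℕ) :
    monodromy V z (n + p) = monodromy V z n * monodromy V z p := by
  induction n with
  | zero => simp [monodromy]
  | succ n ih =>
    rw [add_right_comm, monodromy, ih, monodromy, Matrix.mul_assoc]
    have : ((n + p : ℕ) : ℤ) + 1 = (n + 1 : ℤ) + p := by push_cast; ring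
    rw [transferMatrix, transferMatrix, this, hV]

theorem halfLineSolution_add_period {p : ℕ} (hV : Function.Periodic V (p : ℤ)) {w : ℂ}
    (hv : monodromy V z p *ᵥ v = w • v) (n : ℕ) :
    halfLineSolution V z v (n + p) = w * halfLineSolution V z v n := by
  rw [halfLineSolution, monodromy_add_period hV, ← Matrix.mulVec_mulVec, hv, Matrix.mulVec_smul,
    halfLineSolution, Pi.smul_apply, smul_eq_mul]

end HalfLine

/-! ### Floquet solutions and Weyl sequences -/

theorem exists_monodromy_eigenvector (V : ℤ → ℝ) (p : ℕ) (z : ℂ) {w : ℂ}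
    (hw : w ^ 2 - discriminant V p z * w + 1 = 0) :
    ∃ v : Fin 2 → ℂ, v ≠ 0 ∧ monodromy V z p *ᵥ v = w • v := by
  have hdet : (monodromy V z p - w • 1).det = 0 := by
    have h := det_monodromy V z p
    rw [Matrix.det_fin_two] at h ⊢
    rw [discriminant, Matrix.trace_fin_two] at hw
    simp only [Matrix.sub_apply, Matrix.smul_apply, Matrix.one_apply_eq, smul_eq_mul, mul_one,
      Matrix.one_apply_ne (show (0 : Fin 2) ≠ 1 by decide),
      Matrix.one_apply_ne (show (1 : Fin 2) ≠ 0 by decide), mul_zero, sub_zero]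
    linear_combination hw + h
  obtain ⟨v, hv, h⟩ := Matrix.exists_mulVec_eq_zero_iff.mpr hdet
  refine ⟨v, hv, ?_⟩
  rwa [Matrix.sub_mulVec, Matrix.smul_mulVec, Matrix.one_mulVec, sub_eq_zero] at h

theorem schrodingerOperator_single (V : ℤ → ℝ) (hV : BddAbove (range fun n => |V n|)) (n : ℤ)
    (a : ℂ) :
    schrodingerOperator V hV (lp.single 2 n a) =
      lp.single 2 (n + 1) a + lp.single 2 (n - 1) a + lp.single 2 n (V n * a) := by
  ext k
  rw [schrodingerOperator_apply]
  simp only [lp.coeFn_add, Pi.add_apply, lp.single_apply, Pi.single_apply]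
  have h1 : k - 1 = n ↔ k = n + 1 := by omega
  have h2 : k + 1 = n ↔ k = n - 1 := by omega
  simp only [h1, h2, mul_ite, mul_zero]
  congr 1
  by_cases h : k = n <;> simp [h]

/-- Inside the window the difference equation cancels everything, leaving only boundary terms at the
two ends. Their size does not grow with `L` when the solution is bounded. -/
theorem schrodingerOperator_truncation (V : ℤ → ℝ) (hV : BddAbove (range fun n => |V n|)) (z : ℂ)
    (v : Fin 2 → ℂ) (L : ℕ) :
    (schrodingerOperator V hV - z • 1)
        (∑ n ∈ Finset.range (L + 1), lp.single 2 (n : ℤ) (halfLineSolution V z v n)) =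
      lp.single 2 (-1) (halfLineSolution V z v 0) +
        lp.single 2 0 (halfLineSolution V z v 1 - (z - V 0) * halfLineSolution V z v 0) +
        lp.single 2 ((L : ℤ) + 1) (halfLineSolution V z v L) -
        lp.single 2 (L : ℤ) (halfLineSolution V z v (L + 1)) := by
  have hsingle (n : ℤ) (a : ℂ) : (schrodingerOperator V hV - z • 1) (lp.single 2 n a) =
      lp.single 2 (n + 1) a + lp.single 2 (n - 1) a - lp.single 2 n ((z - V n) * a) := by
    rw [sub_apply, schrodingerOperator_single, smul_apply,
      one_apply_eq_self, ← lp.single_smul, sub_mul, lp.single_sub, smul_eq_mul]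
    abel
  induction L with
  | zero =>
    rw [zero_add, Finset.sum_range_one, hsingle, lp.single_sub]
    simp only [Nat.cast_zero, zero_add, zero_sub]
    abel
  | succ L ih =>
    rw [Finset.sum_range_succ, map_add, ih, hsingle, halfLineSolution_add_two]
    push_cast
    rw [add_sub_cancel_right]
    simp only [lp.single_sub]
    abel

/-- A left inverse of `H - z` would bound the truncations by a multiple of their bounded images,
while their norms tend to infinity. -/
theorem mem_spectrum_of_bounded_solution {V : ℤ → ℝ} (hV : BddAbove (range fun n => |V n|))
    {z : ℂ} {v : Fin 2 → ℂ} {C : ℝ} (hC : ∀ n, ‖halfLineSolution V z v n‖ ≤ C)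
    (hdiv : Tendsto (fun L : ℕ => ∑ n ∈ Finset.range (L + 1), ‖halfLineSolution V z v n‖ ^ 2)
      atTop atTop) : z ∈ spectrum ℂ (schrodingerOperator V hV) := by
  by_contra hz
  rw [spectrum.mem_iff, not_not, Algebra.algebraMap_eq_smul_one, ← IsUnit.neg_iff, neg_sub] at hz
  obtain ⟨R, hR⟩ := hz.exists_left_inv
  set φ : ℕ → ℓ²(ℤ, ℂ) := fun L =>
    ∑ n ∈ Finset.range (L + 1), lp.single 2 (n : ℤ) (halfLineSolution V z v n) with hφ
  set D := ‖halfLineSolution V z v 1 - (z - V 0) * halfLineSolution V z v 0‖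
  have hbd (L : ℕ) : ‖φ L‖ ≤ ‖R‖ * (C + D + C + C) := by
    have h1 : R ((schrodingerOperator V hV - z • 1) (φ L)) = φ L := by
      rw [← mul_apply_eq_comp, hR, one_apply_eq_self]
    rw [← h1]
    refine (R.le_opNorm _).trans (mul_le_mul_of_nonneg_left ?_ (norm_nonneg _))
    rw [hφ, schrodingerOperator_truncation]
    refine (norm_sub_le _ _).trans (add_le_add ((norm_add_le _ _).trans (add_le_add
      ((norm_add_le _ _).trans (add_le_add ?_ ?_)) ?_)) ?_) <;>
    rw [lp.norm_single (by norm_num)]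
    exacts [hC _, hC _, hC _]
  have hnorm (L : ℕ) : ‖φ L‖ ^ 2 =
      ∑ n ∈ Finset.range (L + 1), ‖halfLineSolution V z v n‖ ^ 2 := by
    have h := lp.norm_sum_single (p := 2) (E := fun _ : ℤ => ℂ) (by norm_num)
      (fun n : ℤ => halfLineSolution V z v n.toNat)
      ((Finset.range (L + 1)).map Nat.castEmbedding)
    simpa [Finset.sum_map] using h
  obtain ⟨L, hL⟩ := (hdiv.eventually_gt_atTop ((‖R‖ * (C + D + C + C)) ^ 2)).exists
  rw [← hnorm] at hL
  exact absurd hL (not_lt.mpr (pow_le_pow_left₀ (norm_nonneg _) (hbd L) 2))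

theorem mem_spectrum_of_eigenvalue {V : ℤ → ℝ} {p : ℕ} (hp : 0 < p)
    (hV : Function.Periodic V (p : ℤ)) {z w : ℂ} (hw1 : ‖w‖ = 1)
    (hw : w ^ 2 - discriminant V p z * w + 1 = 0) :
    z ∈ spectrum ℂ (schrodingerOperator V (bddAbove_of_periodic hp hV)) := by
  obtain ⟨v, hv0, hv⟩ := exists_monodromy_eigenvector V p z hw
  have hper : Function.Periodic (fun n => ‖halfLineSolution V z v n‖) p := fun n => by
    simp only [halfLineSolution_add_period hV hv, norm_mul, hw1, one_mul]
  obtain ⟨C, hC⟩ : ∃ C, ∀ n, ‖halfLineSolution V z v n‖ ≤ C := by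
    refine ⟨∑ k ∈ Finset.range p, ‖halfLineSolution V z v k‖, fun n => ?_⟩
    have h1 : ‖halfLineSolution V z v n‖ = ‖halfLineSolution V z v (n % p)‖ :=
      (hper.map_mod_nat n).symm
    rw [h1]
    exact Finset.single_le_sum (f := fun k => ‖halfLineSolution V z v k‖)
      (fun _ _ => norm_nonneg _) (Finset.mem_range.mpr (Nat.mod_lt _ hp))
  obtain ⟨n₀, hn₀⟩ : ∃ n₀, halfLineSolution V z v n₀ ≠ 0 := by
    by_contra! h
    refine hv0 (funext fun i => ?_)
    fin_cases i
    · simpa [halfLineSolution_one] using h 1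
    · simpa [halfLineSolution_zero] using h 0
  refine mem_spectrum_of_bounded_solution _ hC ?_
  -- Along `n₀ + k p` the summand is a nonzero constant, so it cannot tend to zero.
  have hns : ¬ Summable fun n => ‖halfLineSolution V z v n‖ ^ 2 := by
    intro h
    have h1 := h.tendsto_atTop_zero.comp
      (tendsto_atTop_mono (fun k => (Nat.le_mul_of_pos_right k hp).trans (Nat.le_add_left _ n₀))
        tendsto_id : Tendsto (fun k : ℕ => n₀ + k * p) atTop atTop)
    have h2 : (fun n => ‖halfLineSolution V z v n‖ ^ 2) ∘ (fun k : ℕ => n₀ + k * p) =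
        fun _ => ‖halfLineSolution V z v n₀‖ ^ 2 := by
      funext k
      have := hper.nat_mul k n₀
      simp only [Function.comp_apply]
      simp only [Nat.cast_id] at this
      rw [this]
    rw [h2, tendsto_const_nhds_iff] at h1
    exact hn₀ (by simpa using h1)
  exact ((not_summable_iff_tendsto_nat_atTop_of_nonneg fun _ => by positivity).mp hns).comp
    (tendsto_add_atTop_nat 1)

/-- For a real number `t` in `[-2, 2]`, the equation `w + w⁻¹ = t` has a unimodular solution. -/
theorem exists_unimodular_root {t : ℝ} (ht : |t| ≤ 2) :
    ∃ w : ℂ, ‖w‖ = 1 ∧ w ^ 2 - t * w + 1 = 0 := by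
  have h4 : 0 ≤ 4 - t ^ 2 := by nlinarith [abs_le.mp ht]
  have hs := Real.sq_sqrt h4
  set s := √(4 - t ^ 2)
  refine ⟨⟨t / 2, s / 2⟩, ?_, ?_⟩
  · rw [← sq_eq_sq₀ (norm_nonneg _) zero_le_one, Complex.sq_norm, Complex.normSq_mk]
    nlinarith
  · refine Complex.ext ?_ ?_
    · simp [sq, Complex.add_re, Complex.mul_re]
      nlinarith
    · simp [sq, Complex.add_im, Complex.mul_im]
      ring

/-! ### Reality of the discriminant and the description of the spectrum -/

theorem conj_monodromy (V : ℤ → ℝ) (z : ℂ) (m : ℕ) :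
    (monodromy V z m).map conj = monodromy V (conj z) m := by
  rw [monodromy_eq_transferProduct, monodromy_eq_transferProduct, transferProduct_map]
  simp

theorem conj_discriminant (V : ℤ → ℝ) (p : ℕ) (z : ℂ) :
    conj (discriminant V p z) = discriminant V p (conj z) := by
  rw [discriminant, discriminant, ← conj_monodromy, Matrix.trace_fin_two, Matrix.trace_fin_two,
    map_add]
  rfl

theorem discriminant_ofReal (V : ℤ → ℝ) (p : ℕ) (x : ℝ) :
    discriminant V p x = ((discriminant V p x).re : ℂ) :=
  (Complex.conj_eq_iff_re.mp (by rw [conj_discriminant, Complex.conj_ofReal])).symm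

theorem mem_spectralSet_iff {V : ℤ → ℝ} {p : ℕ} (hp : 0 < p) (hV : Function.Periodic V (p : ℤ))
    (x : ℝ) : x ∈ spectralSet hp hV ↔ |(discriminant V p x).re| ≤ 2 := by
  constructor
  · intro h
    have := norm_discriminant_le_two hp hV h
    rwa [discriminant_ofReal, Complex.norm_real, Real.norm_eq_abs] at this
  · intro h
    obtain ⟨w, hw1, hw⟩ := exists_unimodular_root h
    exact mem_spectrum_of_eigenvalue hp hV hw1 (by rwa [discriminant_ofReal])

/-! ### Existence of the Marchenko–Ostrovski map -/

section Wronskian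

variable {V : ℤ → ℝ} {z : ℂ} {v : Fin 2 → ℂ}

/-- Discrete Green identity for a solution and its conjugate: since `V` is real, only `Im z`
contributes to the increment. -/
theorem wronskian_succ (n : ℕ) :
    (conj (halfLineSolution V z v (n + 1)) * halfLineSolution V z v (n + 2)).im =
      (conj (halfLineSolution V z v n) * halfLineSolution V z v (n + 1)).im +
        z.im * ‖halfLineSolution V z v (n + 1)‖ ^ 2 := by
  rw [halfLineSolution_add_two, Complex.sq_norm, Complex.normSq_apply]
  simp only [Complex.mul_im, Complex.conj_re, Complex.conj_im, Complex.sub_re, Complex.sub_im,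
    Complex.mul_re, Complex.ofReal_re, Complex.ofReal_im]
  ring

theorem wronskian_eq_sum (n : ℕ) :
    (conj (halfLineSolution V z v n) * halfLineSolution V z v (n + 1)).im =
      (conj (halfLineSolution V z v 0) * halfLineSolution V z v 1).im +
        z.im * ∑ k ∈ Finset.range n, ‖halfLineSolution V z v (k + 1)‖ ^ 2 := by
  induction n with
  | zero => simp
  | succ n ih => rw [wronskian_succ, ih, Finset.sum_range_succ]; ring

variable {p : ℕ} {w : ℂ}

theorem wronskian_period (hV : Function.Periodic V (p : ℤ))
    (hv : monodromy V z p *ᵥ v = w • v) :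
    (conj (halfLineSolution V z v p) * halfLineSolution V z v (p + 1)).im =
      ‖w‖ ^ 2 * (conj (halfLineSolution V z v 0) * halfLineSolution V z v 1).im := by
  have h0 := halfLineSolution_add_period hV hv 0
  have h1 := halfLineSolution_add_period hV hv 1
  rw [zero_add] at h0
  rw [add_comm] at h1
  rw [h0, h1, Complex.sq_norm, Complex.normSq_apply]
  simp only [map_mul, Complex.mul_im, Complex.conj_re, Complex.conj_im, Complex.mul_re]
  ring

/-- Over one period the Wronskian `W` is multiplied by `‖w‖²` and also increases by a positive
amount, so `(‖w‖² - 1) W > 0`. With `‖w‖ ≤ 1` this fixes both signs. -/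
theorem wronskian_neg (hV : Function.Periodic V (p : ℤ)) (hp : 0 < p) (hz : 0 < z.im)
    (hv : monodromy V z p *ᵥ v = w • v) (hv0 : v ≠ 0) (hw0 : w ≠ 0) (hw : ‖w‖ ≤ 1) :
    ‖w‖ < 1 ∧ (conj (halfLineSolution V z v 0) * halfLineSolution V z v 1).im < 0 := by
  have h1 := wronskian_period hV hv
  rw [wronskian_eq_sum p] at h1
  -- If the solution vanished at the sites `1, …, p`, then `u p = w * u 0` would make both initial
  -- values zero.
  have hpos : 0 < ∑ k ∈ Finset.range p, ‖halfLineSolution V z v (k + 1)‖ ^ 2 := by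
    by_contra! h
    have hz := (Finset.sum_eq_zero_iff_of_nonneg
      (s := Finset.range p) (f := fun k => ‖halfLineSolution V z v (k + 1)‖ ^ 2)
      fun _ _ => by positivity).mp (le_antisymm h (Finset.sum_nonneg fun _ _ => by positivity))
    have hu (k : ℕ) (hk : k < p) : halfLineSolution V z v (k + 1) = 0 := by
      simpa using hz k (Finset.mem_range.mpr hk)
    have hu1 := hu 0 hp
    have hup := hu (p - 1) (Nat.sub_lt hp one_pos)
    rw [Nat.sub_add_cancel (Nat.one_le_of_lt hp), ← zero_add p, halfLineSolution_add_period hV hv,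
      mul_eq_zero, or_iff_right hw0, halfLineSolution_zero] at hup
    rw [zero_add, halfLineSolution_one] at hu1
    refine hv0 (funext fun i => ?_)
    fin_cases i
    exacts [hu1, hup]
  have h2 := mul_pos hz hpos
  have hw2 : ‖w‖ ^ 2 ≤ 1 := pow_le_one₀ (norm_nonneg _) hw
  refine ⟨lt_of_le_of_ne hw fun h => ?_, ?_⟩
  · rw [h] at h1
    linarith
  · by_contra! h
    nlinarith

theorem discriminant_not_mem (hV : Function.Periodic V (p : ℤ)) (hp : 0 < p) (hz : 0 < z.im)
    {t : ℝ} (ht : |t| ≤ 2) : discriminant V p z ≠ t := by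
  intro h
  obtain ⟨w, hw1, hw⟩ := exists_unimodular_root ht
  rw [← h] at hw
  obtain ⟨v, hv0, hv⟩ := exists_monodromy_eigenvector V p z hw
  have hw0 : w ≠ 0 := by
    rintro rfl
    simp at hw1
  exact (wronskian_neg hV hp hz hv hv0 hw0 hw1.le).1.ne hw1

/-- The solution with `u 0 = 0` and `u 1 = 1` cannot vanish at `p`, because its Wronskian starts at
zero and increases strictly from the second step. This keeps the Weyl vector nonzero. -/
theorem monodromy_one_zero_ne_zero (hp : 0 < p) (hz : 0 < z.im) : monodromy V z p 1 0 ≠ 0 := by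
  intro h
  have h1 : halfLineSolution V z ![1, 0] p = 0 := by
    simp [halfLineSolution, Matrix.mulVec, dotProduct, Fin.sum_univ_two, h]
  have h2 := wronskian_eq_sum (V := V) (z := z) (v := ![1, 0]) p
  rw [h1, halfLineSolution_zero] at h2
  have h3 : 0 < ∑ k ∈ Finset.range p, ‖halfLineSolution V z ![1, 0] (k + 1)‖ ^ 2 := by
    refine Finset.sum_pos' (fun _ _ => by positivity) ⟨0, Finset.mem_range.mpr hp, ?_⟩
    simp [halfLineSolution_one]
  have h4 := mul_pos hz h3
  simp at h2
  rcases h2 with h2 | h2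
  · exact hz.ne' h2
  · exact h3.ne' h2

end Wronskian

/-! ### The inverse Joukowski map -/

/-- The inverse Joukowski map: the root of `w ^ 2 - t * w + 1` in the open unit disc. -/
def joukowskiInv (t : ℂ) : ℂ := t / 2 * (1 - (1 - 4 / t ^ 2) ^ (1 / 2 : ℂ))

/-- A value `1 - 4 / t² ≤ 0` would mean `t² = 4 / r` with `r ≥ 1`, hence `t` real in `[-2, 2]`. So
the principal square root is analytic off the segment. -/
theorem mem_slitPlane_of_not_mem_segment {t : ℂ} (ht : ∀ s : ℝ, |s| ≤ 2 → t ≠ s) :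
    1 - 4 / t ^ 2 ∈ slitPlane := by
  have ht0 : t ≠ 0 := by simpa using ht 0 (by norm_num)
  by_contra h
  rw [Complex.mem_slitPlane_iff_not_le_zero, not_not, Complex.nonpos_iff] at h
  obtain ⟨r, hr⟩ : ∃ r : ℝ, 4 / t ^ 2 = r := by
    refine ⟨(4 / t ^ 2).re, Complex.ext rfl ?_⟩
    simpa using h.2
  have hr1 : 1 ≤ r := by
    have := h.1
    rw [hr] at this
    simpa using this
  have h2 : t ^ 2 = ((2 / √r : ℝ) : ℂ) ^ 2 := by
    have : (r : ℂ) ≠ 0 := by exact_mod_cast (by linarith : r ≠ 0)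
    rw [← Complex.ofReal_pow, div_pow, Real.sq_sqrt (by linarith), Complex.ofReal_div, ← hr]
    push_cast
    field_simp
    norm_num
  have h3 : |2 / √r| ≤ 2 := by
    rw [abs_of_nonneg (by positivity)]
    exact div_le_self (by norm_num) (Real.one_le_sqrt.mpr hr1)
  rcases sq_eq_sq_iff_eq_or_eq_neg.mp h2 with h | h
  · exact ht _ h3 h
  · exact ht (-(2 / √r)) (by rwa [abs_neg]) (by rw [h, Complex.ofReal_neg])

theorem analyticAt_joukowskiInv {t : ℂ} (ht : ∀ s : ℝ, |s| ≤ 2 → t ≠ s) :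
    AnalyticAt ℂ joukowskiInv t := by
  have ht0 : t ≠ 0 := by simpa using ht 0 (by norm_num)
  unfold joukowskiInv
  refine AnalyticAt.mul (by fun_prop) (analyticAt_const.sub ?_)
  refine AnalyticAt.cpow ?_ analyticAt_const (mem_slitPlane_of_not_mem_segment ht)
  exact analyticAt_const.sub (analyticAt_const.div (by fun_prop) (pow_ne_zero 2 ht0))

theorem joukowskiInv_root {t : ℂ} (ht : ∀ s : ℝ, |s| ≤ 2 → t ≠ s) :
    joukowskiInv t ^ 2 - t * joukowskiInv t + 1 = 0 := by
  have ht0 : t ≠ 0 := by simpa using ht 0 (by norm_num)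
  have hs : ((1 - 4 / t ^ 2) ^ (1 / 2 : ℂ)) ^ 2 = 1 - 4 / t ^ 2 := by
    rw [← Complex.cpow_nat_mul]
    simp
  have h4 : t ^ 2 * (4 / t ^ 2) = 4 := by field_simp
  rw [joukowskiInv]
  linear_combination t ^ 2 / 4 * hs - h4 / 4

/-- The principal root `s` has positive real part, so `‖1 - s‖ < ‖1 + s‖`. The two roots of the
quadratic have product 1, so the smaller lies inside the disc. -/
theorem norm_joukowskiInv_lt_one {t : ℂ} (ht : ∀ s : ℝ, |s| ≤ 2 → t ≠ s) :
    ‖joukowskiInv t‖ < 1 := by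
  have ht0 : t ≠ 0 := by simpa using ht 0 (by norm_num)
  have hslit := mem_slitPlane_of_not_mem_segment ht
  set s := (1 - 4 / t ^ 2) ^ (1 / 2 : ℂ) with hsdef
  have hs : s ^ 2 = 1 - 4 / t ^ 2 := by
    rw [hsdef, ← Complex.cpow_nat_mul]
    simp
  have hre : 0 < s.re := by
    rw [hsdef, Complex.cpow_def_of_ne_zero (Complex.slitPlane_ne_zero hslit), Complex.exp_re]
    refine mul_pos (Real.exp_pos _) (Real.cos_pos_of_mem_Ioo ?_)
    have h1 : (Complex.log (1 - 4 / t ^ 2) * (1 / 2)).im = Complex.arg (1 - 4 / t ^ 2) / 2 := by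
      rw [show (1 / 2 : ℂ) = ((1 / 2 : ℝ) : ℂ) by push_cast; rfl, Complex.im_mul_ofReal,
        Complex.log_im]
      ring
    rw [h1]
    have h2 := (Complex.mem_slitPlane_iff_arg.mp hslit).1
    have h3 := Complex.neg_pi_lt_arg (1 - 4 / t ^ 2)
    have h4 := lt_of_le_of_ne (Complex.arg_le_pi (1 - 4 / t ^ 2)) h2
    constructor <;> linarith
  have hprod : joukowskiInv t * (t / 2 * (1 + s)) = 1 := by
    have h4 : t ^ 2 * (4 / t ^ 2) = 4 := by field_simp
    rw [joukowskiInv, ← hsdef]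
    linear_combination -(t ^ 2 / 4) * hs + h4 / 4
  have hlt : ‖joukowskiInv t‖ < ‖t / 2 * (1 + s)‖ := by
    rw [joukowskiInv, ← hsdef, norm_mul, norm_mul]
    refine mul_lt_mul_of_pos_left ?_ (norm_pos_iff.mpr (div_ne_zero ht0 two_ne_zero))
    rw [← sq_lt_sq₀ (norm_nonneg _) (norm_nonneg _), Complex.sq_norm, Complex.sq_norm,
      Complex.normSq_apply, Complex.normSq_apply]
    simp only [Complex.sub_re, Complex.add_re, Complex.sub_im, Complex.add_im, Complex.one_re,
      Complex.one_im]
    nlinarith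
  have h := congrArg norm hprod
  rw [norm_mul, norm_one] at h
  by_contra! h1
  nlinarith [norm_nonneg (joukowskiInv t)]

theorem differentiable_monodromy (V : ℤ → ℝ) (m : ℕ) (i j : Fin 2) :
    Differentiable ℂ fun z => monodromy V z m i j := by
  induction m generalizing i j with
  | zero => exact differentiable_const _
  | succ m ih =>
    simp only [monodromy, Matrix.mul_apply, Fin.sum_univ_two]
    have h (k : Fin 2) : Differentiable ℂ fun z => transferMatrix V z (m + 1) i k := by
      unfold transferMatrix
      fin_cases i <;> fin_cases k <;> simp
    exact ((h 0).mul (ih 0 j)).add ((h 1).mul (ih 1 j))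

theorem differentiable_discriminant (V : ℤ → ℝ) (p : ℕ) :
    Differentiable ℂ (discriminant V p) := by
  unfold discriminant
  simp only [Matrix.trace_fin_two]
  exact (differentiable_monodromy V p 0 0).add (differentiable_monodromy V p 1 1)

/-! ### The Weyl solution and the construction of `Θ` -/

/-- The decaying Floquet multiplier. -/
def floquetMultiplier (V : ℤ → ℝ) (p : ℕ) (z : ℂ) : ℂ := joukowskiInv (discriminant V p z)

/-- The initial data of the decaying Floquet solution. -/
def weylVector (V : ℤ → ℝ) (p : ℕ) (z : ℂ) : Fin 2 → ℂ :=
  ![floquetMultiplier V p z - monodromy V z p 1 1, monodromy V z p 1 0]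

theorem monodromy_mulVec_weylVector {V : ℤ → ℝ} {p : ℕ} (hV : Function.Periodic V (p : ℤ))
    (hp : 0 < p) {z : ℂ} (hz : 0 < z.im) :
    monodromy V z p *ᵥ weylVector V p z = floquetMultiplier V p z • weylVector V p z := by
  have hroot : floquetMultiplier V p z ^ 2 - discriminant V p z * floquetMultiplier V p z + 1 = 0 :=
    joukowskiInv_root fun s hs => discriminant_not_mem hV hp hz hs
  have hdet := det_monodromy V z p
  rw [Matrix.det_fin_two] at hdet
  rw [discriminant, Matrix.trace_fin_two] at hroot
  funext i
  fin_cases i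
  · simp [weylVector, Matrix.mulVec, dotProduct, Fin.sum_univ_two]
    linear_combination -hroot - hdet
  · simp [weylVector, Matrix.mulVec, dotProduct, Fin.sum_univ_two]
    ring

/-- The ratio has the sign of the Wronskian at `n`. The Wronskian is nondecreasing, and at the end
of the period it is `‖w‖²` times its negative initial value, so it is negative throughout. -/
theorem weyl_ratio_im_neg {V : ℤ → ℝ} {p : ℕ} (hV : Function.Periodic V (p : ℤ)) (hp : 0 < p)
    {z : ℂ} (hz : 0 < z.im) {n : ℕ} (hn : n < p) :
    (halfLineSolution V z (weylVector V p z) (n + 1) /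
      halfLineSolution V z (weylVector V p z) n).im < 0 := by
  have hseg (s : ℝ) (hs : |s| ≤ 2) : discriminant V p z ≠ s := discriminant_not_mem hV hp hz hs
  have hw0 : floquetMultiplier V p z ≠ 0 := by
    intro h
    have := joukowskiInv_root hseg
    rw [← floquetMultiplier, h] at this
    simp at this
  have hv0 : weylVector V p z ≠ 0 := fun h =>
    monodromy_one_zero_ne_zero (V := V) hp hz (by simpa [weylVector] using congrFun h 1)
  have hv := monodromy_mulVec_weylVector hV hp hz
  have hneg := (wronskian_neg hV hp hz hv hv0 hw0 (norm_joukowskiInv_lt_one hseg).le).2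
  set u := halfLineSolution V z (weylVector V p z) with hu
  have hWn : (conj (u n) * u (n + 1)).im < 0 := by
    have h1 := wronskian_eq_sum (V := V) (z := z) (v := weylVector V p z) n
    have h2 := wronskian_eq_sum (V := V) (z := z) (v := weylVector V p z) p
    have h3 : ∑ k ∈ Finset.range n, ‖u (k + 1)‖ ^ 2 ≤ ∑ k ∈ Finset.range p, ‖u (k + 1)‖ ^ 2 :=
      Finset.sum_le_sum_of_subset_of_nonneg (Finset.range_mono hn.le) fun _ _ _ => by positivity
    rw [wronskian_period hV hv] at h2
    rw [← hu] at h1 h2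
    have h4 := mul_le_mul_of_nonneg_left h3 hz.le
    have h5 : ‖floquetMultiplier V p z‖ ^ 2 * (conj (u 0) * u 1).im < 0 :=
      mul_neg_of_pos_of_neg (by positivity) hneg
    linarith
  have hun : u n ≠ 0 := by
    intro h
    simp [h] at hWn
  have h1 : u (n + 1) / u n = ((‖u n‖ ^ 2)⁻¹ : ℝ) * (conj (u n) * u (n + 1)) := by
    have : (conj (u n)) ≠ 0 := (map_ne_zero _).mpr hun
    rw [Complex.ofReal_inv, Complex.ofReal_pow, ← Complex.conj_mul']
    field_simp
  rw [h1, Complex.im_ofReal_mul]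
  exact mul_neg_of_pos_of_neg (by positivity) hWn

/-- Taking the logarithm factor by factor fixes the branch: each argument lies in `(-π, 0)`, so the
average of the `p` arguments lies in `[-π, 0]`. The product of the ratios telescopes to the
multiplier. -/
theorem exists_isMarchenkoOstrovski {V : ℤ → ℝ} {p : ℕ} (hV : Function.Periodic V (p : ℤ))
    (hp : 0 < p) : ∃ Θ : ℂ → ℂ, IsMarchenkoOstrovski V p Θ := by
  have hp0 : (p : ℂ) ≠ 0 := by exact_mod_cast hp.ne'
  have hpR : (0 : ℝ) < p := by exact_mod_cast hp
  set u : ℂ → ℕ → ℂ := fun z => halfLineSolution V z (weylVector V p z) with hu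
  set S : ℂ → ℂ := fun z => ∑ n ∈ Finset.range p, Complex.log (u z (n + 1) / u z n) with hS
  have hratio {z : ℂ} (hz : 0 < z.im) {n : ℕ} (hn : n < p) : (u z (n + 1) / u z n).im < 0 :=
    weyl_ratio_im_neg hV hp hz hn
  have hu0 {z : ℂ} (hz : 0 < z.im) {n : ℕ} (hn : n < p) : u z n ≠ 0 ∧ u z (n + 1) ≠ 0 := by
    have h := hratio hz hn
    constructor <;> intro h0 <;> simp [h0] at h
  have hseg {z : ℂ} (hz : 0 < z.im) (s : ℝ) (hs : |s| ≤ 2) : discriminant V p z ≠ s :=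
    discriminant_not_mem hV hp hz hs
  have hexp {z : ℂ} (hz : 0 < z.im) : Complex.exp (S z) = floquetMultiplier V p z := by
    rw [hS, Complex.exp_sum]
    have h1 : ∀ n ∈ Finset.range p, Complex.exp (Complex.log (u z (n + 1) / u z n)) =
        u z (n + 1) / u z n := fun n hn => by
      obtain ⟨h1, h2⟩ := hu0 hz (Finset.mem_range.mp hn)
      exact Complex.exp_log (div_ne_zero h2 h1)
    rw [Finset.prod_congr rfl h1]
    have h2 (m : ℕ) (hm : m ≤ p) : ∏ n ∈ Finset.range m, u z (n + 1) / u z n = u z m / u z 0 := by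
      induction m with
      | zero => rw [Finset.prod_range_zero, div_self (hu0 hz hp).1]
      | succ m ih =>
        rw [Finset.prod_range_succ, ih (by omega), div_mul_div_cancel₀' (hu0 hz hm).1]
    rw [h2 p le_rfl]
    have h3 := halfLineSolution_add_period hV (monodromy_mulVec_weylVector hV hp hz) 0
    rw [zero_add] at h3
    rw [div_eq_iff (hu0 hz hp).1]
    exact h3
  have hpΘ (z : ℂ) : (p : ℂ) * (-I / p * S z) = -I * S z := by field_simp
  have hre (z : ℂ) : (-I / p * S z).re = (S z).im / p := by
    have : -I / p * S z = ((1 / p : ℝ) : ℂ) * (-I * S z) := by push_cast; ring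
    rw [this, Complex.re_ofReal_mul]
    simp
    ring
  have him (z : ℂ) : (-I / p * S z).im = -(S z).re / p := by
    have : -I / p * S z = ((1 / p : ℝ) : ℂ) * (-I * S z) := by push_cast; ring
    rw [this, Complex.im_ofReal_mul]
    simp
    ring
  refine ⟨fun z => -I / p * S z, ⟨?_, ?_, ?_, ?_⟩⟩
  · intro z hz
    have hB : AnalyticAt ℂ (floquetMultiplier V p) z :=
      (analyticAt_joukowskiInv (hseg hz)).comp
        ((differentiable_discriminant V p).analyticAt z)
    have hua (n : ℕ) : AnalyticAt ℂ (fun z => u z n) z := by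
      simp only [hu, halfLineSolution, Matrix.mulVec, dotProduct, Fin.sum_univ_two, weylVector,
        Matrix.cons_val_zero, Matrix.cons_val_one]
      have hm (i j : Fin 2) (m : ℕ) : AnalyticAt ℂ (fun z => monodromy V z m i j) z :=
        (differentiable_monodromy V m i j).analyticAt z
      exact ((hm _ _ _).mul (hB.sub (hm _ _ _))).add ((hm _ _ _).mul (hm _ _ _))
    refine analyticAt_const.mul (Finset.analyticAt_fun_sum _ fun n hn => ?_)
    have hn := Finset.mem_range.mp hn
    refine AnalyticAt.clog ((hua _).div (hua _) (hu0 hz hn).1) ?_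
    exact Or.inr (hratio hz hn).ne
  · intro z hz
    have h1 := norm_joukowskiInv_lt_one (hseg hz)
    rw [← floquetMultiplier, ← hexp hz, Complex.norm_exp, Real.exp_lt_one_iff] at h1
    simp only [upperHalf, mem_ofPred_eq, him]
    exact div_pos (by linarith) hpR
  · intro z hz
    simp only [hre]
    simp only [hS, Complex.im_sum, Complex.log_im]
    have h1 : ∀ n ∈ Finset.range p, Complex.arg (u z (n + 1) / u z n) ∈ Icc (-Real.pi) 0 :=
      fun n hn => ⟨(Complex.neg_pi_lt_arg _).le,
        (Complex.arg_neg_iff.mpr (hratio hz (Finset.mem_range.mp hn))).le⟩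
    refine ⟨?_, div_nonpos_of_nonpos_of_nonneg (Finset.sum_nonpos fun n hn => (h1 n hn).2) hpR.le⟩
    rw [le_div_iff₀ hpR]
    have := Finset.card_nsmul_le_sum _ _ _ fun n hn => (h1 n hn).1
    rw [Finset.card_range, nsmul_eq_mul] at this
    linarith
  · intro z hz
    have hroot := joukowskiInv_root (hseg hz)
    rw [← floquetMultiplier, ← hexp hz] at hroot
    rw [Complex.two_cos, hpΘ]
    have e1 : -I * S z * I = S z := by linear_combination -(S z) * Complex.I_mul_I
    have e2 : -(-I * S z) * I = -S z := by linear_combination (S z) * Complex.I_mul_I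
    rw [e1, e2, Complex.exp_neg]
    have h0 := Complex.exp_ne_zero (S z)
    field_simp
    linear_combination -hroot

/-! ### Functions analytic at a real point and real on the real line -/

/-- `g` is analytic at `x` and real at the real points near `x`. -/
structure IsRealAnalyticAt (g : ℂ → ℂ) (x : ℝ) : Prop where
  analyticAt : AnalyticAt ℂ g x
  im_eq_zero : ∀ᶠ y : ℝ in 𝓝 x, (g y).im = 0

theorem im_eq_zero_of_punctured {g : ℂ → ℂ} {x : ℝ} (hg : ContinuousAt g x)
    (h : ∀ᶠ y : ℝ in 𝓝[≠] x, (g y).im = 0) : (g x).im = 0 := by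
  have h1 : Tendsto (fun y : ℝ => (g y).im) (𝓝[≠] x) (𝓝 (g x).im) :=
    ((Complex.continuous_im.continuousAt.comp
      (hg.comp (f := ((↑) : ℝ → ℂ)) Complex.continuous_ofReal.continuousAt)).tendsto).mono_left
      nhdsWithin_le_nhds
  exact tendsto_nhds_unique (h1.congr' h) tendsto_const_nhds

theorem IsRealAnalyticAt.of_punctured {g : ℂ → ℂ} {x : ℝ} (hg : AnalyticAt ℂ g x)
    (h : ∀ᶠ y : ℝ in 𝓝[≠] x, (g y).im = 0) : IsRealAnalyticAt g x := by
  refine ⟨hg, ?_⟩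
  filter_upwards [eventually_nhdsWithin_iff.mp h] with y hy
  by_cases hyx : y = x
  · rw [hyx]
    exact im_eq_zero_of_punctured hg.continuousAt h
  · exact hy hyx

theorem IsRealAnalyticAt.im_self {g : ℂ → ℂ} {x : ℝ} (hg : IsRealAnalyticAt g x) :
    (g x).im = 0 := hg.im_eq_zero.self_of_nhds

theorem IsRealAnalyticAt.ofReal_re {g : ℂ → ℂ} {x : ℝ} (hg : IsRealAnalyticAt g x) :
    ((g x).re : ℂ) = g x := Complex.ext rfl (by simp [hg.im_self])

theorem analyticAt_dslope {g : ℂ → ℂ} {x : ℂ} (hg : AnalyticAt ℂ g x) :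
    AnalyticAt ℂ (dslope g x) x := by
  obtain ⟨q, hq⟩ := hg
  exact ⟨_, hq.has_fpower_series_dslope_fslope⟩

/-- Dividing out `z - x` shifts the Taylor coefficients by one. -/
theorem iteratedDeriv_dslope {g : ℂ → ℂ} {x : ℂ} (hg : AnalyticAt ℂ g x) (n : ℕ) :
    iteratedDeriv n (dslope g x) x / n.factorial =
      iteratedDeriv (n + 1) g x / (n + 1).factorial := by
  have h1 := hg.hasFPowerSeriesAt.has_fpower_series_dslope_fslope
  have h2 := (analyticAt_dslope hg).hasFPowerSeriesAt
  have h3 := congrArg (fun q => q.coeff n) (h2.eq_formalMultilinearSeries h1)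
  simpa [FormalMultilinearSeries.coeff_fslope, FormalMultilinearSeries.coeff_ofScalars] using h3

theorem IsRealAnalyticAt.dslope {g : ℂ → ℂ} {x : ℝ} (hg : IsRealAnalyticAt g x) :
    IsRealAnalyticAt (dslope g x) x := by
  refine .of_punctured (analyticAt_dslope hg.analyticAt) ?_
  filter_upwards [nhdsWithin_le_nhds hg.im_eq_zero, self_mem_nhdsWithin] with y hy hyx
  rw [dslope_of_ne _ (by exact_mod_cast hyx), slope_def_module, ← Complex.ofReal_sub,
    ← Complex.ofReal_inv, smul_eq_mul, Complex.im_ofReal_mul, Complex.sub_im, hy, hg.im_self]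
  simp

theorem IsRealAnalyticAt.deriv_im {g : ℂ → ℂ} {x : ℝ} (hg : IsRealAnalyticAt g x) :
    (deriv g x).im = 0 := by
  rw [← dslope_same]
  exact hg.dslope.im_self

theorem IsRealAnalyticAt.eventually {g : ℂ → ℂ} {x : ℝ} (hg : IsRealAnalyticAt g x) :
    ∀ᶠ y : ℝ in 𝓝 x, IsRealAnalyticAt g y := by
  filter_upwards [Complex.continuous_ofReal.continuousAt.eventually
    hg.analyticAt.eventually_analyticAt, hg.im_eq_zero.eventually_nhds] with y h1 h2
  exact ⟨h1, h2⟩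

theorem IsRealAnalyticAt.iteratedDeriv {g : ℂ → ℂ} {x : ℝ} (hg : IsRealAnalyticAt g x) (n : ℕ) :
    IsRealAnalyticAt (iteratedDeriv n g) x := by
  induction n generalizing x with
  | zero => simpa using hg
  | succ n ih =>
    rw [iteratedDeriv_succ]
    exact ⟨(ih hg).analyticAt.deriv, (ih hg).eventually.mono fun y hy => hy.deriv_im⟩

theorem IsRealAnalyticAt.congr {f g : ℂ → ℂ} {x : ℝ} (hg : IsRealAnalyticAt g x)
    (h : f =ᶠ[𝓝 (x : ℂ)] g) : IsRealAnalyticAt f x := by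
  refine ⟨hg.analyticAt.congr h.symm, ?_⟩
  filter_upwards [hg.im_eq_zero, Complex.continuous_ofReal.continuousAt.eventually h] with y h1 h2
  rw [h2, h1]

theorem IsRealAnalyticAt.div {f g : ℂ → ℂ} {x : ℝ} (hf : IsRealAnalyticAt f x)
    (hg : IsRealAnalyticAt g x) (h0 : g x ≠ 0) : IsRealAnalyticAt (fun z => f z / g z) x := by
  refine ⟨hf.analyticAt.div hg.analyticAt h0, ?_⟩
  filter_upwards [hf.im_eq_zero, hg.im_eq_zero] with y h1 h2
  rw [Complex.div_im, h1, h2]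
  simp

/-- The points `x + r e^{iφ}`, `r → 0+`, tend to `x` within the upper half-plane. -/
theorem tendsto_ray {x φ : ℝ} (hφ : φ ∈ Ioo 0 Real.pi) :
    Tendsto (fun r : ℝ => (x : ℂ) + r * Complex.exp (φ * I)) (𝓝[>] 0)
      (𝓝[upperHalf] (x : ℂ)) := by
  refine tendsto_nhdsWithin_iff.mpr ⟨?_, ?_⟩
  · have : Continuous fun r : ℝ => (x : ℂ) + r * Complex.exp (φ * I) := by fun_prop
    simpa using (this.tendsto 0).mono_left nhdsWithin_le_nhds
  · filter_upwards [self_mem_nhdsWithin] with r hr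
    have h1 : (Complex.exp (φ * I)).im = Real.sin φ := Complex.exp_ofReal_mul_I_im φ
    simp only [upperHalf, mem_ofPred_eq, Complex.add_im, Complex.ofReal_im,
      Complex.im_ofReal_mul, h1, zero_add]
    exact mul_pos hr (Real.sin_pos_of_mem_Ioo hφ)

/-- Write `g - g x = (z - x)^n h` with `h x` real and nonzero. Along the ray of angle `φ` the
imaginary part has the sign of `h x * sin (n φ)`, which changes on `(0, π)` once `n ≥ 2`. So `n = 1`
and `h x > 0`. -/
theorem IsRealAnalyticAt.deriv_pos {g : ℂ → ℂ} {x : ℝ} (hg : IsRealAnalyticAt g x)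
    (hpos : ∀ᶠ z in 𝓝[upperHalf] (x : ℂ), 0 ≤ (g z).im)
    (hnc : ¬ ∀ᶠ z in 𝓝 (x : ℂ), g z = g x) : 0 < (deriv g x).re := by
  obtain ⟨n, h, hh, hh0, heq⟩ := (AnalyticAt.exists_eventuallyEq_pow_smul_nonzero_iff
    (hg.analyticAt.sub (analyticAt_const (v := g x)))).mpr (by simpa [sub_eq_zero] using hnc)
  simp only [Pi.sub_apply, smul_eq_mul] at heq
  have him : (h x).im = 0 := by
    refine im_eq_zero_of_punctured hh.continuousAt ?_
    filter_upwards [nhdsWithin_le_nhds hg.im_eq_zero, self_mem_nhdsWithin,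
      nhdsWithin_le_nhds (Complex.continuous_ofReal.continuousAt.eventually heq)] with y h1 h2 h3
    have h4 : h y = (((y - x) ^ n)⁻¹ : ℝ) * (g y - g x) := by
      have : ((y : ℂ) - x) ^ n ≠ 0 := pow_ne_zero _ (sub_ne_zero.mpr (by exact_mod_cast h2))
      rw [h3]
      push_cast
      field_simp
    rw [h4, Complex.im_ofReal_mul, Complex.sub_im, h1, hg.im_self]
    simp
  have hray {φ : ℝ} (hφ : φ ∈ Ioo 0 Real.pi) : 0 ≤ (h x).re * Real.sin (n * φ) := by
    have ht : Tendsto (fun r : ℝ => (Complex.exp ((n * φ : ℝ) * I) *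
        h ((x : ℂ) + r * Complex.exp (φ * I))).im) (𝓝[>] 0)
        (𝓝 (Complex.exp ((n * φ : ℝ) * I) * h x).im) := by
      refine (Complex.continuous_im.tendsto _).comp (Tendsto.const_mul _ ?_)
      exact hh.continuousAt.tendsto.comp ((tendsto_ray hφ).mono_right nhdsWithin_le_nhds)
    have h1 : (Complex.exp ((n * φ : ℝ) * I) * h x).im = (h x).re * Real.sin (n * φ) := by
      rw [Complex.mul_im, him, Complex.exp_ofReal_mul_I_im]
      ring
    rw [h1] at ht
    refine ge_of_tendsto ht ?_
    filter_upwards [self_mem_nhdsWithin, (tendsto_ray hφ).eventually hpos,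
      ((tendsto_ray hφ).mono_right nhdsWithin_le_nhds).eventually heq] with r hr h2 h3
    have h4 : g (x + r * Complex.exp (φ * I)) - g x = ((r ^ n : ℝ) : ℂ) *
        (Complex.exp ((n * φ : ℝ) * I) * h (x + r * Complex.exp (φ * I))) := by
      rw [h3, add_sub_cancel_left, mul_pow, ← Complex.exp_nat_mul]
      push_cast
      ring_nf
    have h5 := congrArg Complex.im h4
    rw [Complex.im_ofReal_mul, Complex.sub_im, hg.im_self, sub_zero] at h5
    rw [h5] at h2
    exact nonneg_of_mul_nonneg_right h2 (pow_pos hr n)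
  have hre : (h x).re ≠ 0 := fun h0 => hh0 (Complex.ext h0 him)
  have hπ := Real.pi_pos
  rcases lt_trichotomy n 1 with hn | hn | hn
  · obtain rfl : n = 0 := by omega
    have := heq.self_of_nhds
    simp at this
    exact absurd this.symm hh0
  · subst hn
    have h1 : deriv g x = h x := by
      have h2 : HasDerivAt (fun z => g x + (z - x) * h z) (1 * h x + ((x : ℂ) - x) * deriv h x) x :=
        (((hasDerivAt_id (x : ℂ)).sub_const (x : ℂ)).mul
          hh.differentiableAt.hasDerivAt).const_add (g x)
      have h3 : g =ᶠ[𝓝 (x : ℂ)] fun z => g x + (z - x) * h z := by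
        filter_upwards [heq] with z hz
        rw [pow_one] at hz
        rw [← hz]
        ring
      rw [(h2.congr_of_eventuallyEq h3).deriv]
      ring
    rw [h1]
    have h2 := hray (φ := Real.pi / 2) ⟨by linarith, by linarith⟩
    rw [Nat.cast_one, one_mul, Real.sin_pi_div_two, mul_one] at h2
    exact lt_of_le_of_ne h2 hre.symm
  · exfalso
    have hn0 : (0 : ℝ) < n := by positivity
    have hn2 : (2 : ℝ) ≤ n := by exact_mod_cast hn
    -- The two angles make `n φ` equal to `π/2` and `3π/2`, where the sine is `1` and `-1`.
    have h1 := hray (φ := Real.pi / 2 / n) ⟨by positivity, by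
      rw [div_lt_iff₀ hn0]; nlinarith⟩
    have h2 := hray (φ := (Real.pi / 2 + Real.pi) / n) ⟨by positivity, by
      rw [div_lt_iff₀ hn0]; nlinarith⟩
    rw [mul_div_cancel₀ _ hn0.ne', Real.sin_pi_div_two] at h1
    rw [mul_div_cancel₀ _ hn0.ne', Real.sin_add_pi, Real.sin_pi_div_two] at h2
    exact hre (by linarith)

/-! ### Julia's lemma for self-maps of the upper half-plane -/

/-- The regular part at `x` of `-1 / (g - g x)`. -/
def juliaRemainder (g : ℂ → ℂ) (x z : ℂ) : ℂ :=
  dslope (dslope g x) x z / (deriv g x * dslope g x z)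

theorem juliaRemainder_eq {g : ℂ → ℂ} {x z : ℂ} (hx : deriv g x ≠ 0) (hzx : z ≠ x)
    (hz : g z ≠ g x) :
    juliaRemainder g x z = -1 / (g z - g x) + 1 / (deriv g x * (z - x)) := by
  have h1 : z - x ≠ 0 := sub_ne_zero.mpr hzx
  have h2 : g z - g x ≠ 0 := sub_ne_zero.mpr hz
  rw [juliaRemainder, dslope_of_ne _ hzx, slope_def_module, dslope_same, dslope_of_ne _ hzx,
    slope_def_module, smul_eq_mul, smul_eq_mul]
  field_simp
  ring

section Julia

variable {F g : ℂ → ℂ} {x : ℝ}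

theorem isRealAnalyticAt_juliaRemainder (hg : IsRealAnalyticAt g x) (ha : 0 < (deriv g x).re) :
    IsRealAnalyticAt (juliaRemainder g x) x := by
  have h0 : deriv g x ≠ 0 := fun h => by simp [h] at ha
  refine hg.dslope.dslope.div ⟨analyticAt_const.mul hg.dslope.analyticAt, ?_⟩ ?_
  · filter_upwards [hg.dslope.im_eq_zero] with y hy
    rw [Complex.mul_im, hy, hg.deriv_im]
    simp
  · simpa [dslope_same] using h0

theorem eventually_juliaRemainder_eq (hpos : ∀ z ∈ upperHalf, 0 < (F z).im)
    (hg : IsRealAnalyticAt g x) (hFg : ∀ᶠ z in 𝓝[upperHalf] (x : ℂ), F z = g z)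
    (ha : 0 < (deriv g x).re) : ∀ᶠ z in 𝓝[upperHalf] (x : ℂ),
      juliaRemainder g x z = -1 / (F z - g x) + 1 / (deriv g x * (z - x)) := by
  filter_upwards [hFg, self_mem_nhdsWithin] with z hz hzU
  rw [hz]
  refine juliaRemainder_eq (fun h => by simp [h] at ha) ?_ ?_
  · rintro rfl
    simp [upperHalf] at hzU
  · intro h
    have := hpos z hzU
    rw [hz, h, hg.im_self] at this
    exact lt_irrefl _ this

theorem im_neg_one_div (w : ℂ) : (-1 / w).im = w.im / normSq w := by
  rw [neg_div, Complex.neg_im, one_div, Complex.inv_im]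
  ring

theorem im_one_div_ofReal_mul (a : ℝ) (w : ℂ) :
    (1 / ((a : ℂ) * w)).im = -(w.im / (a * normSq w)) := by
  rw [one_div, mul_inv, ← Complex.ofReal_inv, Complex.im_ofReal_mul, Complex.inv_im]
  field_simp

/-- The first summand has nonnegative imaginary part, the second is small for large `z` and, away
from `x`, near the real line. Near `x` the poles cancel and the sum is continuous with real value at
`x`. The maximum principle for `exp (i K)` transports the lower bound inside. -/
theorem julia (hF : AnalyticOnNhd ℂ F upperHalf) (hpos : ∀ z ∈ upperHalf, 0 < (F z).im)
    (hg : IsRealAnalyticAt g x) (hFg : ∀ᶠ z in 𝓝[upperHalf] (x : ℂ), F z = g z)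
    (ha : 0 < (deriv g x).re) {z₀ : ℂ} (hz₀ : z₀ ∈ upperHalf) :
    0 ≤ (-1 / (F z₀ - g x) + 1 / (deriv g x * (z₀ - x))).im := by
  set a := (deriv g x).re with hadef
  have haC : deriv g x = (a : ℂ) := Complex.ext rfl (by simp [hg.deriv_im])
  set K : ℂ → ℂ := fun z => -1 / (F z - g x) + 1 / (deriv g x * (z - x)) with hK
  have hne {z : ℂ} (hz : z ∈ upperHalf) : F z - g x ≠ 0 ∧ z - x ≠ 0 := by
    constructor <;> intro h <;> have h := congrArg Complex.im h
    · rw [Complex.sub_im, hg.im_self, Complex.zero_im, sub_zero] at h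
      exact (hpos z hz).ne' h
    · rw [Complex.sub_im, Complex.ofReal_im, Complex.zero_im, sub_zero] at h
      exact (ne_of_gt hz : z.im ≠ 0) h
  have hKlow {z : ℂ} (hz : z ∈ upperHalf) : -(z.im / (a * normSq (z - x))) ≤ (K z).im := by
    have h1 : 0 ≤ (-1 / (F z - g x)).im := by
      rw [im_neg_one_div, Complex.sub_im, hg.im_self, sub_zero]
      exact div_nonneg (hpos z hz).le (normSq_nonneg _)
    have h2 : (1 / (deriv g x * (z - x))).im = -(z.im / (a * normSq (z - x))) := by
      rw [haC, im_one_div_ofReal_mul]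
      simp
    rw [hK, Complex.add_im, h2]
    linarith
  have hKan {z : ℂ} (hz : z ∈ upperHalf) : AnalyticAt ℂ K z := by
    have h0 : deriv g x ≠ 0 := fun h => by simp [hadef, h] at ha
    have h1 := hF z hz
    exact (analyticAt_const.div (h1.sub analyticAt_const) (hne hz).1).add
      (analyticAt_const.div (analyticAt_const.mul (analyticAt_id.sub analyticAt_const))
        (mul_ne_zero h0 (hne hz).2))
  refine le_of_forall_pos_le_add fun η hη => ?_
  suffices h : -η ≤ (K z₀).im by linarith
  have hnear : ∀ᶠ z in 𝓝[upperHalf] (x : ℂ), -η < (K z).im := by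
    have hk := isRealAnalyticAt_juliaRemainder hg ha
    have h1 : ∀ᶠ z in 𝓝[upperHalf] (x : ℂ), -η < (juliaRemainder g x z).im := by
      refine nhdsWithin_le_nhds ?_
      refine (Complex.continuous_im.continuousAt.comp hk.analyticAt.continuousAt).eventually
        (lt_mem_nhds ?_)
      simp only [Function.comp_apply, hk.im_self]
      linarith
    filter_upwards [h1, eventually_juliaRemainder_eq hpos hg hFg ha] with z h2 h3
    rwa [h3] at h2
  obtain ⟨δ, hδ, hδK⟩ := Metric.mem_nhdsWithin_iff.mp hnear
  -- `R` controls the arc and `ε` below controls the flat side outside the `δ`-ball. Both losses are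
  -- at most `η`.
  obtain ⟨R, hR0, hRη, hRz⟩ : ∃ R : ℝ, 0 < R ∧ 1 / (a * R) ≤ η ∧ ‖z₀ - x‖ < R := by
    refine ⟨max (1 / (a * η)) (‖z₀ - x‖ + 1), ?_, ?_, ?_⟩
    · exact lt_max_of_lt_left (by positivity)
    · rw [div_le_iff₀ (mul_pos ha (lt_max_of_lt_left (by positivity)))]
      have := le_max_left (1 / (a * η)) (‖z₀ - x‖ + 1)
      calc 1 = η * (a * (1 / (a * η))) := by field_simp
        _ ≤ _ := by gcongr
    · exact lt_max_of_lt_right (by linarith)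
  obtain ⟨ε, hε0, hεη, hεz⟩ : ∃ ε : ℝ, 0 < ε ∧ ε / (a * δ ^ 2) ≤ η ∧ ε < z₀.im := by
    have hz₀' : 0 < z₀.im := hz₀
    refine ⟨min (η * (a * δ ^ 2)) (z₀.im / 2), lt_min (by positivity) (by linarith), ?_, ?_⟩
    · rw [div_le_iff₀ (by positivity)]
      exact min_le_left _ _
    · exact (min_le_right _ _).trans_lt (by linarith)
  set U : Set ℂ := {z | ε < z.im} ∩ Metric.ball (x : ℂ) R with hU
  have hUo : IsOpen U := (isOpen_lt continuous_const Complex.continuous_im).inter Metric.isOpen_ball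
  have hcl : closure U ⊆ {z | ε ≤ z.im} ∩ Metric.closedBall (x : ℂ) R :=
    closure_minimal (inter_subset_inter (fun z (hz : ε < z.im) => hz.le)
      Metric.ball_subset_closedBall)
      ((isClosed_le continuous_const Complex.continuous_im).inter Metric.isClosed_closedBall)
  have hclU {z : ℂ} (hz : z ∈ closure U) : z ∈ upperHalf := hε0.trans_le (hcl hz).1
  have hnorm (z : ℂ) : ‖Complex.exp (I * K z)‖ = Real.exp (-(K z).im) := by
    rw [Complex.norm_exp, Complex.I_mul_re]
  have hmax := Complex.norm_le_of_forall_mem_frontier_norm_le (f := fun z => Complex.exp (I * K z))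
    (U := U) (C := Real.exp η) (Metric.isBounded_ball.subset inter_subset_right) ?_ ?_
    (subset_closure (show z₀ ∈ U from ⟨hεz, by simpa [dist_eq_norm] using hRz⟩))
  · rw [hnorm, Real.exp_le_exp] at hmax
    linarith
  · refine DifferentiableOn.diffContOnCl fun z hz => ?_
    exact ((hKan (hclU hz)).differentiableAt.const_mul I).cexp.differentiableWithinAt
  · intro z hz
    have hzcl := frontier_subset_closure hz
    have hzH := hclU hzcl
    have hz1 : ε ≤ z.im := (hcl hzcl).1
    rw [hnorm, Real.exp_le_exp, neg_le]
    have hzU : z ∉ U := by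
      rw [hUo.frontier_eq] at hz
      exact hz.2
    by_cases hball : z ∈ Metric.ball (x : ℂ) δ
    · exact (hδK ⟨hball, hzH⟩).le
    refine le_trans (neg_le_neg ?_) (hKlow hzH)
    have hδ2 : δ ^ 2 ≤ normSq (z - x) := by
      rw [Metric.mem_ball, not_lt, dist_eq_norm] at hball
      rw [Complex.normSq_eq_norm_sq]
      gcongr
    by_cases hzR : z ∈ Metric.ball (x : ℂ) R
    · have hzε : z.im = ε := le_antisymm (not_lt.mp fun h => hzU ⟨h, hzR⟩) hz1
      rw [hzε]
      exact (by gcongr : ε / (a * normSq (z - x)) ≤ ε / (a * δ ^ 2)).trans hεη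
    · rw [Metric.mem_ball, not_lt, dist_eq_norm] at hzR
      refine le_trans ?_ hRη
      have h1 : z.im ≤ ‖z - x‖ := by
        have := (le_abs_self _).trans (Complex.abs_im_le_norm (z - x))
        simpa using this
      have h2 : 0 < ‖z - x‖ := norm_pos_iff.mpr (hne hzH).2
      rw [Complex.normSq_eq_norm_sq]
      calc z.im / (a * ‖z - x‖ ^ 2) ≤ ‖z - x‖ / (a * ‖z - x‖ ^ 2) := by gcongr
        _ = 1 / (a * ‖z - x‖) := by field_simp
        _ ≤ 1 / (a * R) := by gcongr

/-- The boundary derivative of a self-map of the upper half-plane is bounded below. -/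
theorem le_boundary_deriv (hF : AnalyticOnNhd ℂ F upperHalf)
    (hpos : ∀ z ∈ upperHalf, 0 < (F z).im) (hg : IsRealAnalyticAt g x)
    (hFg : ∀ᶠ z in 𝓝[upperHalf] (x : ℂ), F z = g z) (ha : 0 < (deriv g x).re) {z : ℂ}
    (hz : z ∈ upperHalf) : z.im * (F z).im / normSq (z - x) ≤ (deriv g x).re := by
  have h := julia hF hpos hg hFg ha hz
  have haC : deriv g x = ((deriv g x).re : ℂ) := Complex.ext rfl (by simp [hg.deriv_im])
  have hz0 : 0 < z.im := hz
  have hF0 := hpos z hz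
  rw [haC, Complex.add_im, im_neg_one_div, im_one_div_ofReal_mul, Complex.sub_im, hg.im_self,
    Complex.sub_im, Complex.ofReal_im, sub_zero, sub_zero] at h
  set a := (deriv g x).re
  have hN : 0 < normSq (z - x) := by
    rw [Complex.normSq_pos]
    intro h
    have := congrArg Complex.im h
    simp at this
    exact hz0.ne' this
  have hM : (F z).im ^ 2 ≤ normSq (F z - g x) := by
    rw [Complex.normSq_apply, Complex.sub_im, hg.im_self, sub_zero]
    nlinarith [mul_self_nonneg (F z - g x).re]
  have h1 : (F z).im / normSq (F z - g x) ≤ 1 / (F z).im := by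
    rw [div_le_div_iff₀ (lt_of_lt_of_le (by positivity) hM) hF0]
    nlinarith
  have h2 : z.im / (a * normSq (z - x)) ≤ 1 / (F z).im := by linarith
  rw [div_le_div_iff₀ (by positivity) hF0] at h2
  rw [div_le_iff₀ hN]
  linarith

/-- Up to the factor `1 / (6 g')`, the right-hand side is the Schwarzian derivative of `g` at `x`.
-/
theorem deriv_juliaRemainder (hg : AnalyticAt ℂ g x) (h0 : deriv g x ≠ 0) :
    deriv (juliaRemainder g x) x =
      (iteratedDeriv 3 g x / 6 * deriv g x - (iteratedDeriv 2 g x / 2) ^ 2) / deriv g x ^ 3 := by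
  have hh := analyticAt_dslope hg
  have hl := analyticAt_dslope hh
  have e1 : deriv (dslope g x) x = iteratedDeriv 2 g x / 2 := by
    simpa using iteratedDeriv_dslope hg 1
  have e2 : deriv (dslope (dslope g x) x) x = iteratedDeriv 3 g x / 6 := by
    have h1 := iteratedDeriv_dslope hh 1
    have h2 := iteratedDeriv_dslope hg 2
    norm_num [Nat.factorial] at h1 h2
    rw [h1, h2]
  have h := (hl.differentiableAt.hasDerivAt.div
    (hh.differentiableAt.hasDerivAt.const_mul (deriv g x)) (by
      rw [dslope_same]; exact mul_ne_zero h0 h0)).deriv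
  rw [dslope_same, dslope_same, e1, e2] at h
  refine Eq.trans h ?_
  field_simp

theorem isPreconnected_upperHalf : IsPreconnected upperHalf :=
  (convex_halfSpace_im_gt 0).isPreconnected

/-- A self-map of the upper half-plane with bounded real part has positive third derivative at
the boundary points through which it extends to a function real on the real line. -/
theorem iteratedDeriv_three_pos (hF : AnalyticOnNhd ℂ F upperHalf)
    (hpos : ∀ z ∈ upperHalf, 0 < (F z).im) {C : ℝ} (hC : ∀ z ∈ upperHalf, |(F z).re| ≤ C)
    (hg : IsRealAnalyticAt g x) (hFg : ∀ᶠ z in 𝓝[upperHalf] (x : ℂ), F z = g z)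
    (ha : 0 < (deriv g x).re) : 0 < (iteratedDeriv 3 g x).re := by
  have hk := isRealAnalyticAt_juliaRemainder hg ha
  have hkeq := eventually_juliaRemainder_eq hpos hg hFg ha
  have h0 : deriv g x ≠ 0 := fun h => by simp [h] at ha
  have hkder := deriv_juliaRemainder hg.analyticAt h0
  have haC : deriv g x = ((deriv g x).re : ℂ) := Complex.ext rfl (by simp [hg.deriv_im])
  have h2C := (hg.iteratedDeriv 2).ofReal_re.symm
  have h3C := (hg.iteratedDeriv 3).ofReal_re.symm
  set a := (deriv g x).re
  set b := (iteratedDeriv 2 g x).re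
  set c := (iteratedDeriv 3 g x).re
  have hder : deriv (juliaRemainder g x) x = ((c / 6 * a - (b / 2) ^ 2) / a ^ 3 : ℝ) := by
    rw [hkder, haC, h2C, h3C]
    push_cast
    rfl
  -- In the constant case the Schwarzian vanishes, so `c ≤ 0` would force `b = 0`. The remainder is
  -- then zero and `F` is affine with slope `a > 0`, against the bound on its real part.
  by_cases hconst : ∀ᶠ z in 𝓝 (x : ℂ), juliaRemainder g x z = juliaRemainder g x x
  · have hd0 : deriv (juliaRemainder g x) x = 0 := by
      rw [Filter.EventuallyEq.deriv_eq (f := fun _ => juliaRemainder g x x) hconst, deriv_const]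
    rw [hd0, eq_comm, Complex.ofReal_eq_zero, div_eq_zero_iff,
      or_iff_left (pow_ne_zero 3 ha.ne')] at hder
    by_contra! hc
    have hb : b = 0 := by
      have : b ^ 2 ≤ 0 := by nlinarith
      exact pow_eq_zero_iff two_ne_zero |>.mp (le_antisymm this (sq_nonneg b))
    have hkx : juliaRemainder g x x = 0 := by
      have h1 := iteratedDeriv_dslope hg.analyticAt 1
      simp only [iteratedDeriv_one, Nat.factorial_one, Nat.cast_one, div_one, Nat.reduceAdd, h2C,
        hb] at h1
      rw [juliaRemainder, dslope_same, h1]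
      simp
    have haff : ∀ᶠ z in 𝓝[upperHalf] (x : ℂ), F z = g x + deriv g x * (z - x) := by
      filter_upwards [hkeq, nhdsWithin_le_nhds hconst, self_mem_nhdsWithin] with z h1 h2 hz
      rw [h2, hkx] at h1
      have hz1 : z - x ≠ 0 := by
        intro h
        have := congrArg Complex.im h
        simp at this
        exact (ne_of_gt hz : z.im ≠ 0) this
      have hz2 : F z - g x ≠ 0 := by
        intro h
        have := congrArg Complex.im h
        rw [Complex.sub_im, hg.im_self, Complex.zero_im, sub_zero] at this
        exact (hpos z hz).ne' this
      field_simp at h1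
      linear_combination -h1
    obtain ⟨U, hU, hUo, hxU⟩ := eventually_nhds_iff.mp (eventually_nhdsWithin_iff.mp haff)
    obtain ⟨w, hw⟩ : (U ∩ upperHalf).Nonempty := by
      have h1 := (tendsto_ray (x := x) (φ := Real.pi / 2)
        ⟨by positivity, by linarith [Real.pi_pos]⟩)
      exact (h1.eventually (inter_mem (nhdsWithin_le_nhds (hUo.mem_nhds hxU))
        self_mem_nhdsWithin)).exists.imp' _ fun _ h => h
    have hHo : IsOpen upperHalf := isOpen_lt continuous_const Complex.continuous_im
    have hall : EqOn F (fun z => g x + deriv g x * (z - x)) upperHalf := by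
      refine hF.eqOn_of_preconnected_of_eventuallyEq (fun z _ => ?_) isPreconnected_upperHalf hw.2 ?_
      · fun_prop
      · filter_upwards [(hUo.inter hHo).mem_nhds hw] with z hz
        exact hU z hz.1 hz.2
    -- On the horizontal line at height 1 the affine function has real part `g x + a t`, which is
    -- unbounded.
    have hre (t : ℝ) : |(g x).re + a * t| ≤ C := by
      have hm : (x : ℂ) + t + I ∈ upperHalf := by simp [upperHalf]
      have h1 := hC _ hm
      rw [hall hm, haC] at h1
      simpa [add_sub_cancel_left, add_assoc] using h1
    have hC0 : 0 ≤ C := (abs_nonneg _).trans (hre 0)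
    have h1 := (abs_le.mp (hre ((C + 1 - (g x).re) / a))).2
    rw [mul_div_cancel₀ _ ha.ne'] at h1
    linarith
  · have h1 := hk.deriv_pos ?_ hconst
    · rw [hder, Complex.ofReal_re] at h1
      have h2 : 0 < c / 6 * a - (b / 2) ^ 2 := by
        by_contra! h
        exact absurd h1 (not_lt.mpr (div_nonpos_of_nonpos_of_nonneg h (by positivity)))
      by_contra! hc
      nlinarith [sq_nonneg (b / 2)]
    · filter_upwards [hkeq, self_mem_nhdsWithin] with z h2 hz
      rw [h2]
      exact julia hF hpos hg hFg ha hz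

end Julia

/-! ### Analytic continuation through the interior of the spectrum -/

/-- A real-analytic germ which is non-negative on the real line, and not identically zero, is the
square of a real-analytic germ. -/
theorem IsRealAnalyticAt.exists_sqrt {Q : ℂ → ℂ} {x : ℝ} (hQ : IsRealAnalyticAt Q x)
    (hnonneg : ∀ᶠ y : ℝ in 𝓝 x, 0 ≤ (Q y).re) (hne : ¬ ∀ᶠ z in 𝓝 (x : ℂ), Q z = 0) :
    ∃ s : ℂ → ℂ, IsRealAnalyticAt s x ∧ ∀ᶠ z in 𝓝 (x : ℂ), s z ^ 2 = Q z := by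
  obtain ⟨n, h, hh, hh0, heq⟩ :=
    (AnalyticAt.exists_eventuallyEq_pow_smul_nonzero_iff hQ.analyticAt).mpr hne
  simp only [smul_eq_mul] at heq
  have hform : ∀ᶠ y : ℝ in 𝓝[≠] x, h y = (((y - x) ^ n)⁻¹ * (Q y).re : ℝ) := by
    filter_upwards [nhdsWithin_le_nhds hQ.eventually, self_mem_nhdsWithin,
      nhdsWithin_le_nhds (Complex.continuous_ofReal.continuousAt.eventually heq)] with y h1 h2 h3
    have : ((y : ℂ) - x) ^ n ≠ 0 := pow_ne_zero _ (sub_ne_zero.mpr (by exact_mod_cast h2))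
    push_cast
    rw [h1.ofReal_re, h3]
    field_simp
  have hhR : IsRealAnalyticAt h x := .of_punctured hh (hform.mono fun y hy => by
    rw [hy, Complex.ofReal_im])
  have hre0 : (h x).re ≠ 0 := fun h0 => hh0 (Complex.ext h0 hhR.im_self)
  have hlim : Tendsto (fun y : ℝ => (h y).re) (𝓝 x) (𝓝 (h x).re) :=
    (Complex.continuous_re.continuousAt.comp
      (hh.continuousAt.comp (f := ((↑) : ℝ → ℂ)) Complex.continuous_ofReal.continuousAt)).tendsto
  have hpos : 0 < (h x).re := by
    refine lt_of_le_of_ne ?_ hre0.symm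
    refine ge_of_tendsto (hlim.mono_left (nhdsWithin_le_nhds (s := Ioi x))) ?_
    filter_upwards [nhdsWithin_mono x (fun y (hy : x < y) => hy.ne') hform,
      nhdsWithin_le_nhds hnonneg, self_mem_nhdsWithin] with y h1 h2 h3
    rw [h1, Complex.ofReal_re]
    exact mul_nonneg (inv_nonneg.mpr (pow_nonneg (sub_nonneg.mpr (le_of_lt h3)) n)) h2
  have heven : Even n := by
    by_contra hodd
    rw [Nat.not_even_iff_odd] at hodd
    refine absurd hpos (not_lt.mpr ?_)
    refine le_of_tendsto (hlim.mono_left (nhdsWithin_le_nhds (s := Iio x))) ?_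
    filter_upwards [nhdsWithin_mono x (fun y (hy : y < x) => hy.ne) hform,
      nhdsWithin_le_nhds hnonneg, self_mem_nhdsWithin] with y h1 h2 h3
    rw [h1, Complex.ofReal_re]
    exact mul_nonpos_of_nonpos_of_nonneg
      (inv_nonpos.mpr (hodd.pow_nonpos (sub_nonpos.mpr (le_of_lt h3)))) h2
  obtain ⟨m, rfl⟩ := heven
  refine ⟨fun z => (z - x) ^ m * h z ^ (1 / 2 : ℂ), ⟨?_, ?_⟩, ?_⟩
  · refine AnalyticAt.mul (by fun_prop) (hh.cpow analyticAt_const ?_)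
    exact Or.inl hpos
  · filter_upwards [hhR.eventually, hlim.eventually (lt_mem_nhds hpos)] with y h1 h2
    rw [← h1.ofReal_re, show (1 / 2 : ℂ) = ((1 / 2 : ℝ) : ℂ) by push_cast; rfl,
      ← Complex.ofReal_cpow h2.le, ← Complex.ofReal_sub, ← Complex.ofReal_pow,
      ← Complex.ofReal_mul, Complex.ofReal_im]
  · filter_upwards [heq] with z hz
    rw [mul_pow, ← Complex.cpow_nat_mul, hz, ← pow_mul, mul_two]
    simp

/-- A local real-analytic solution of `2 * cos G = t`, given a square root of `4 - t ^ 2`. -/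
theorem IsRealAnalyticAt.exists_arccos {t s : ℂ → ℂ} {x : ℝ} (ht : IsRealAnalyticAt t x)
    (hs : IsRealAnalyticAt s x) (hst : ∀ᶠ z in 𝓝 (x : ℂ), s z ^ 2 = 4 - t z ^ 2) :
    ∃ G : ℂ → ℂ, IsRealAnalyticAt G x ∧ ∀ᶠ z in 𝓝 (x : ℂ), 2 * Complex.cos (G z) = t z := by
  set E : ℂ → ℂ := fun z => (t z + I * s z) / 2 with hE
  have hEan : AnalyticAt ℂ E x :=
    (ht.analyticAt.add (analyticAt_const.mul hs.analyticAt)).div_const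
  have hinv : ∀ᶠ z in 𝓝 (x : ℂ), E z * ((t z - I * s z) / 2) = 1 := by
    filter_upwards [hst] with z hz
    rw [hE]
    linear_combination hz / 4 - s z ^ 2 / 4 * Complex.I_sq
  have hEx : E x ≠ 0 := left_ne_zero_of_mul_eq_one hinv.self_of_nhds
  have hE1 : ∀ᶠ y : ℝ in 𝓝 x, ‖E y‖ = 1 := by
    filter_upwards [ht.eventually, hs.eventually,
      Complex.continuous_ofReal.continuousAt.eventually hst] with y h1 h2 h3
    rw [← h1.ofReal_re, ← h2.ofReal_re] at h3
    have h4 : (s y).re ^ 2 = 4 - (t y).re ^ 2 := by exact_mod_cast h3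
    rw [← sq_eq_sq₀ (norm_nonneg _) zero_le_one, Complex.sq_norm, hE]
    simp only
    rw [← h1.ofReal_re, ← h2.ofReal_re, Complex.normSq_apply]
    simp
    linarith
  refine ⟨fun z => Complex.arg (E x) - I * Complex.log (E z / E x), ⟨?_, ?_⟩, ?_⟩
  · refine analyticAt_const.sub (analyticAt_const.mul ((hEan.div_const).clog ?_))
    rw [div_self hEx]
    exact Complex.one_mem_slitPlane
  · filter_upwards [hE1] with y hy
    rw [Complex.sub_im, Complex.ofReal_im, Complex.I_mul_im, Complex.log_re, norm_div, hy,
      hE1.self_of_nhds]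
    simp
  · filter_upwards [hinv] with z hz
    have hEz : E z ≠ 0 := left_ne_zero_of_mul_eq_one hz
    have h1 : Complex.exp ((Complex.arg (E x) - I * Complex.log (E z / E x)) * I) = E z := by
      have : (Complex.arg (E x) - I * Complex.log (E z / E x)) * I =
          Complex.arg (E x) * I + Complex.log (E z / E x) := by
        linear_combination -(Complex.log (E z / E x)) * Complex.I_mul_I
      have h2 := Complex.norm_mul_exp_arg_mul_I (E x)
      rw [hE1.self_of_nhds, Complex.ofReal_one, one_mul] at h2
      rw [this, Complex.exp_add, h2, Complex.exp_log (div_ne_zero hEz hEx), mul_div_cancel₀ _ hEx]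
    rw [Complex.two_cos, neg_mul, Complex.exp_neg, h1, inv_eq_of_mul_eq_one_right hz, hE]
    ring

/-- Differentiating `sin f = 0` gives `cos f * f' = 0`, and the cosine is nonzero where the sine
vanishes. The constant is a multiple of `π`, hence real. -/
theorem eqOn_const_of_sin_eq_zero {f : ℂ → ℂ} {U : Set ℂ} (hU : IsOpen U) (hc : IsPreconnected U)
    (hf : AnalyticOnNhd ℂ f U) (hsin : ∀ z ∈ U, Complex.sin (f z) = 0) :
    ∃ c : ℝ, ∀ z ∈ U, f z = c := by
  have hd : EqOn (deriv f) 0 U := by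
    intro z hz
    have h1 : HasDerivAt (fun w => Complex.sin (f w)) (Complex.cos (f z) * deriv f z) z :=
      (hf z hz).differentiableAt.hasDerivAt.csin
    have h2 : (fun w => Complex.sin (f w)) =ᶠ[𝓝 z] fun _ => 0 := by
      filter_upwards [hU.mem_nhds hz] with w hw using hsin w hw
    have h3 := h2.deriv_eq
    rw [h1.deriv, deriv_const, mul_eq_zero] at h3
    refine h3.resolve_left fun h4 => ?_
    have := Complex.sin_sq_add_cos_sq (f z)
    rw [hsin z hz, h4] at this
    simp at this
  obtain ⟨c, hc⟩ := hU.exists_is_const_of_deriv_eq_zero hc hf.differentiableOn hd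
  rcases U.eq_empty_or_nonempty with rfl | ⟨w, hw⟩
  · exact ⟨0, by simp⟩
  · obtain ⟨k, hk⟩ := Complex.sin_eq_zero_iff.mp (hsin w hw)
    refine ⟨k * Real.pi, fun z hz => ?_⟩
    rw [hc z hz, ← hc w hw, hk]
    push_cast
    rfl

theorem isOpen_upperHalf : IsOpen upperHalf := isOpen_lt continuous_const Complex.continuous_im

theorem isRealAnalyticAt_discriminant (V : ℤ → ℝ) (p : ℕ) (x : ℝ) :
    IsRealAnalyticAt (discriminant V p) x :=
  ⟨(differentiable_discriminant V p).analyticAt _, .of_forall fun y => by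
    rw [discriminant_ofReal, Complex.ofReal_im]⟩

section MarchenkoOstrovski

variable {V : ℤ → ℝ} {p : ℕ} {Θ : ℂ → ℂ} {x : ℝ}

theorem discriminant_not_locally_const (hp : 0 < p) (hV : Function.Periodic V (p : ℤ)) {t : ℝ}
    (ht : |t| ≤ 2) (x : ℝ) : ¬ ∀ᶠ z in 𝓝 (x : ℂ), discriminant V p z = t := by
  intro h
  obtain ⟨r, h1, h2⟩ := ((tendsto_ray (x := x) (φ := Real.pi / 2)
    ⟨by positivity, by linarith [Real.pi_pos]⟩).eventually
      (inter_mem (nhdsWithin_le_nhds h) self_mem_nhdsWithin)).exists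
  exact discriminant_not_mem hV hp h2 ht h1

theorem four_sub_discriminant_sq_not_locally_zero (hp : 0 < p) (hV : Function.Periodic V (p : ℤ))
    (x : ℝ) : ¬ ∀ᶠ z in 𝓝 (x : ℂ), 4 - discriminant V p z ^ 2 = 0 := by
  intro h
  obtain ⟨r, h1, h2⟩ := ((tendsto_ray (x := x) (φ := Real.pi / 2)
    ⟨by positivity, by linarith [Real.pi_pos]⟩).eventually
      (inter_mem (nhdsWithin_le_nhds h) self_mem_nhdsWithin)).exists
  simp only [mem_ofPred_eq] at h1
  have h3 : discriminant V p (x + r * Complex.exp ((Real.pi / 2 : ℝ) * I)) ^ 2 = 2 ^ 2 := by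
    linear_combination -h1
  rcases sq_eq_sq_iff_eq_or_eq_neg.mp h3 with h | h
  · exact discriminant_not_mem hV hp h2 (t := 2) (by norm_num) (by rw [h]; norm_num)
  · exact discriminant_not_mem hV hp h2 (t := -2) (by norm_num) (by rw [h]; norm_num)

theorem isRealAnalyticAt_four_sub_sq (V : ℤ → ℝ) (p : ℕ) (x : ℝ) :
    IsRealAnalyticAt (fun z => 4 - discriminant V p z ^ 2) x := by
  refine ⟨analyticAt_const.sub ((isRealAnalyticAt_discriminant V p x).analyticAt.pow 2),
    .of_forall fun y => ?_⟩
  rw [discriminant_ofReal, ← Complex.ofReal_pow, Complex.sub_im, Complex.ofReal_im]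
  simp

theorem four_sub_sq_re (V : ℤ → ℝ) (p : ℕ) (x : ℝ) :
    (4 - discriminant V p x ^ 2).re = 4 - (discriminant V p x).re ^ 2 := by
  conv_lhs => rw [discriminant_ofReal, ← Complex.ofReal_pow, Complex.sub_re, Complex.ofReal_re]
  simp

theorem mem_spectralSet_iff_nonneg (hp : 0 < p) (hV : Function.Periodic V (p : ℤ)) (x : ℝ) :
    x ∈ spectralSet hp hV ↔ 0 ≤ 4 - (discriminant V p x).re ^ 2 := by
  rw [mem_spectralSet_iff, sub_nonneg, ← sq_le_sq₀ (abs_nonneg _) zero_le_two, sq_abs]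
  norm_num

/-- Both `p Θ` and the real-analytic `G` have cosine `Δ / 2`, so they agree up to sign and a real
constant, and `G` supplies the continuation. -/
theorem IsMarchenkoOstrovski.exists_local_extension (hΘ : IsMarchenkoOstrovski V p Θ) (hp : 0 < p)
    (hV : Function.Periodic V (p : ℤ)) (hx : x ∈ interior (spectralSet hp hV)) :
    ∃ g : ℂ → ℂ, IsRealAnalyticAt g x ∧ ∀ᶠ z in 𝓝[upperHalf] (x : ℂ), Θ z = g z := by
  have hp0 : (p : ℂ) ≠ 0 := by exact_mod_cast hp.ne'
  have hnonneg : ∀ᶠ y : ℝ in 𝓝 x, 0 ≤ (4 - discriminant V p y ^ 2).re := by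
    filter_upwards [mem_interior_iff_mem_nhds.mp hx] with y hy
    rw [four_sub_sq_re]
    exact (mem_spectralSet_iff_nonneg hp hV y).mp hy
  obtain ⟨s, hs, hsq⟩ := (isRealAnalyticAt_four_sub_sq V p x).exists_sqrt hnonneg
    (four_sub_discriminant_sq_not_locally_zero hp hV x)
  obtain ⟨G, hG, hcos⟩ := (isRealAnalyticAt_discriminant V p x).exists_arccos hs hsq
  obtain ⟨r, hr, hball⟩ := Metric.eventually_nhds_iff_ball.mp
    (hcos.and hG.analyticAt.eventually_analyticAt)
  set U := Metric.ball (x : ℂ) r ∩ upperHalf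
  have hUo : IsOpen U := Metric.isOpen_ball.inter isOpen_upperHalf
  have hUc : IsPreconnected U :=
    ((convex_ball _ _).inter (convex_halfSpace_im_gt 0)).isPreconnected
  have hUx : U ∈ 𝓝[upperHalf] (x : ℂ) :=
    inter_mem (nhdsWithin_le_nhds (Metric.ball_mem_nhds _ hr)) self_mem_nhdsWithin
  have hGU : AnalyticOnNhd ℂ G U := fun z hz => (hball z hz.1).2
  have hΘU : AnalyticOnNhd ℂ (fun z => p * Θ z) U := fun z hz =>
    analyticAt_const.mul (hΘ.analytic z hz.2)
  have hadd : AnalyticOnNhd ℂ (fun z => (p * Θ z + G z) / 2) U := fun z hz =>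
    ((hΘU z hz).add (hGU z hz)).div_const
  have hsub : AnalyticOnNhd ℂ (fun z => (p * Θ z - G z) / 2) U := fun z hz =>
    ((hΘU z hz).sub (hGU z hz)).div_const
  have hprod : ∀ z ∈ U, Complex.sin ((p * Θ z + G z) / 2) *
      Complex.sin ((p * Θ z - G z) / 2) = 0 := by
    intro z hz
    have h1 := (hball z hz.1).1
    have h2 := hΘ.discriminant_eq z hz.2
    have h3 := Complex.cos_sub_cos (p * Θ z) (G z)
    linear_combination h1 / 4 + h2 / 4 + h3 / 2
  -- Analytic functions on a connected open set have no zero divisors, so one sign holds throughout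
  -- `U`.
  rcases AnalyticOnNhd.eq_zero_or_eq_zero_of_mul_eq_zero 
    (fun z hz => (Complex.differentiable_sin.analyticAt _).comp (hadd z hz))
    (fun z hz => (Complex.differentiable_sin.analyticAt _).comp (hsub z hz)) hprod hUc with h | h
  · obtain ⟨c, hc⟩ := eqOn_const_of_sin_eq_zero hUo hUc hadd h
    refine ⟨fun z => (2 * c - G z) / p, ⟨(analyticAt_const.sub hG.analyticAt).div_const, ?_⟩, ?_⟩
    · filter_upwards [hG.im_eq_zero] with y hy
      simp [Complex.div_natCast_im, hy]
    · filter_upwards [hUx] with z hz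
      rw [eq_div_iff hp0]
      linear_combination 2 * hc z hz
  · obtain ⟨c, hc⟩ := eqOn_const_of_sin_eq_zero hUo hUc hsub h
    refine ⟨fun z => (2 * c + G z) / p, ⟨(analyticAt_const.add hG.analyticAt).div_const, ?_⟩, ?_⟩
    · filter_upwards [hG.im_eq_zero] with y hy
      simp [Complex.div_natCast_im, hy]
    · filter_upwards [hUx] with z hz
      rw [eq_div_iff hp0]
      linear_combination 2 * hc z hz

end MarchenkoOstrovski

/-! ### Schwarz reflection -/

theorem nhdsWithin_upperHalf_neBot (x : ℝ) : (𝓝[upperHalf] (x : ℂ)).NeBot :=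
  (tendsto_ray (x := x) (φ := Real.pi / 2) ⟨by positivity, by linarith [Real.pi_pos]⟩).neBot

theorem IsRealAnalyticAt.conj_conj_eventuallyEq {g : ℂ → ℂ} {x : ℝ} (hg : IsRealAnalyticAt g x) :
    ∀ᶠ z in 𝓝 (x : ℂ), conj (g (conj z)) = g z := by
  have han : AnalyticAt ℂ (fun z => conj (g (conj z))) x := by
    rw [Complex.analyticAt_iff_eventually_differentiableAt]
    have hc : Tendsto (fun z : ℂ => conj z) (𝓝 (x : ℂ)) (𝓝 (x : ℂ)) := by
      simpa using Complex.continuous_conj.tendsto (x : ℂ)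
    filter_upwards [hc.eventually hg.analyticAt.eventually_analyticAt] with z hz
    simpa [Function.comp_def] using hz.differentiableAt.conj_conj
  refine (han.frequently_eq_iff_eventually_eq hg.analyticAt).mp ?_
  have ht : Tendsto ((↑) : ℝ → ℂ) (𝓝[≠] x) (𝓝[≠] (x : ℂ)) :=
    tendsto_nhdsWithin_iff.mpr ⟨Complex.continuous_ofReal.continuousAt.mono_left
      nhdsWithin_le_nhds, eventually_mem_nhdsWithin.mono fun y hy => by
        simpa using hy⟩
  refine ht.frequently (Eventually.frequently ?_)
  filter_upwards [nhdsWithin_le_nhds hg.eventually] with y hy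
  rw [Complex.conj_ofReal, ← hy.ofReal_re, Complex.conj_ofReal]

theorem schwarzExtension_eventuallyEq {Θ g : ℂ → ℂ} {x : ℝ} (hg : IsRealAnalyticAt g x)
    (hΘg : ∀ᶠ z in 𝓝[upperHalf] (x : ℂ), Θ z = g z) :
    schwarzExtension Θ =ᶠ[𝓝 (x : ℂ)] g := by
  have h1 := eventually_nhdsWithin_iff.mp hΘg
  have hc : Tendsto (fun z : ℂ => conj z) (𝓝 (x : ℂ)) (𝓝 (x : ℂ)) := by
    simpa using Complex.continuous_conj.tendsto (x : ℂ)
  filter_upwards [h1, hc.eventually h1, hg.conj_conj_eventuallyEq, h1.eventually_nhds,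
    hg.analyticAt.eventually_analyticAt] with z h2 h3 h4 h5 h6
  unfold schwarzExtension
  split_ifs with hz hz'
  · exact h2 hz
  · rw [h3 (by simpa [upperHalf] using hz'), h4]
  · obtain ⟨y, rfl⟩ : ∃ y : ℝ, z = y :=
      ⟨z.re, Complex.ext rfl (le_antisymm (not_lt.mp hz) (not_lt.mp hz'))⟩
    have := nhdsWithin_upperHalf_neBot y
    exact ((h6.continuousAt.tendsto.mono_left nhdsWithin_le_nhds).congr'
      ((eventually_nhdsWithin_iff.mpr h5).mono fun w hw => hw.symm)).limUnder_eq

/-! ### Derivatives of the boundary values -/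

theorem IsRealAnalyticAt.iteratedDeriv_re {g : ℂ → ℂ} {x : ℝ} (hg : IsRealAnalyticAt g x)
    (n : ℕ) : _root_.iteratedDeriv n (fun y : ℝ => (g y).re) x =
      (_root_.iteratedDeriv n g x).re := by
  induction n generalizing x with
  | zero => simp
  | succ n ih =>
    have h : _root_.iteratedDeriv n (fun y : ℝ => (g y).re) =ᶠ[𝓝 x]
        fun y : ℝ => (_root_.iteratedDeriv n g y).re := hg.eventually.mono fun y hy => ih hy
    rw [iteratedDeriv_succ, iteratedDeriv_succ, h.deriv_eq]
    exact (hg.iteratedDeriv n).analyticAt.differentiableAt.hasDerivAt.real_of_complex.deriv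

theorem IsRealAnalyticAt.hasDerivAt_iteratedDeriv_re {g : ℂ → ℂ} {x : ℝ}
    (hg : IsRealAnalyticAt g x) (n : ℕ) :
    HasDerivAt (_root_.iteratedDeriv n (fun y : ℝ => (g y).re))
      (_root_.iteratedDeriv (n + 1) (fun y : ℝ => (g y).re) x) x := by
  have h : _root_.iteratedDeriv n (fun y : ℝ => (g y).re) =ᶠ[𝓝 x]
      fun y : ℝ => (_root_.iteratedDeriv n g y).re :=
    hg.eventually.mono fun y hy => hy.iteratedDeriv_re n
  rw [hg.iteratedDeriv_re (n + 1), iteratedDeriv_succ]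
  exact (hg.iteratedDeriv n).analyticAt.differentiableAt.hasDerivAt.real_of_complex
    |>.congr_of_eventuallyEq h

section Boundary

variable {V : ℤ → ℝ} {p : ℕ} {Θ : ℂ → ℂ} {x : ℝ}
  {hp : 0 < p} {hV : Function.Periodic V (p : ℤ)}

theorem eventually_eq_schwarzExtension (Θ : ℂ → ℂ) (x : ℂ) :
    ∀ᶠ z in 𝓝[upperHalf] x, Θ z = schwarzExtension Θ z := by
  filter_upwards [self_mem_nhdsWithin] with z hz
  exact (if_pos hz).symm

theorem IsMarchenkoOstrovski.isRealAnalyticAt (hΘ : IsMarchenkoOstrovski V p Θ)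
    (hx : x ∈ interior (spectralSet hp hV)) : IsRealAnalyticAt (schwarzExtension Θ) x := by
  obtain ⟨g, hg, hΘg⟩ := hΘ.exists_local_extension hp hV hx
  exact hg.congr (schwarzExtension_eventuallyEq hg hΘg)

theorem IsMarchenkoOstrovski.deriv_re_pos (hΘ : IsMarchenkoOstrovski V p Θ)
    (hx : x ∈ interior (spectralSet hp hV)) : 0 < (deriv (schwarzExtension Θ) x).re := by
  have hg := hΘ.isRealAnalyticAt hx
  have him : ∀ᶠ z in 𝓝[upperHalf] (x : ℂ), 0 < (schwarzExtension Θ z).im := by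
    filter_upwards [eventually_eq_schwarzExtension Θ x, self_mem_nhdsWithin] with z h1 h2
    rw [← h1]
    exact hΘ.mapsTo h2
  refine hg.deriv_pos (him.mono fun z hz => hz.le) fun hc => ?_
  have := nhdsWithin_upperHalf_neBot x
  obtain ⟨z, h1, h2⟩ := (him.and (nhdsWithin_le_nhds hc)).exists
  rw [h2, hg.im_self] at h1
  exact lt_irrefl _ h1

theorem IsMarchenkoOstrovski.hasDerivAt_iteratedDeriv (hΘ : IsMarchenkoOstrovski V p Θ)
    (hx : x ∈ interior (spectralSet hp hV)) (n : ℕ) :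
    HasDerivAt (iteratedDeriv n (boundaryValue Θ)) (iteratedDeriv (n + 1) (boundaryValue Θ) x) x :=
  (hΘ.isRealAnalyticAt hx).hasDerivAt_iteratedDeriv_re n

theorem IsMarchenkoOstrovski.le_deriv_boundaryValue (hΘ : IsMarchenkoOstrovski V p Θ)
    (hx : x ∈ interior (spectralSet hp hV)) {z : ℂ} (hz : z ∈ upperHalf) :
    z.im * (Θ z).im / normSq (z - x) ≤ deriv (boundaryValue Θ) x := by
  have h := (hΘ.isRealAnalyticAt hx).iteratedDeriv_re 1
  rw [iteratedDeriv_one, iteratedDeriv_one] at h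
  exact (le_boundary_deriv hΘ.analytic hΘ.mapsTo (hΘ.isRealAnalyticAt hx)
    (eventually_eq_schwarzExtension Θ x) (hΘ.deriv_re_pos hx) hz).trans_eq h.symm

theorem IsMarchenkoOstrovski.deriv_boundaryValue_pos (hΘ : IsMarchenkoOstrovski V p Θ)
    (hx : x ∈ interior (spectralSet hp hV)) : 0 < deriv (boundaryValue Θ) x := by
  have h := (hΘ.isRealAnalyticAt hx).iteratedDeriv_re 1
  rw [iteratedDeriv_one, iteratedDeriv_one] at h
  exact (hΘ.deriv_re_pos hx).trans_eq h.symm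

theorem IsMarchenkoOstrovski.iteratedDeriv_three_pos (hΘ : IsMarchenkoOstrovski V p Θ)
    (hx : x ∈ interior (spectralSet hp hV)) : 0 < iteratedDeriv 3 (boundaryValue Θ) x := by
  refine (PeriodicSchrodinger.iteratedDeriv_three_pos hΘ.analytic hΘ.mapsTo (C := Real.pi)
    (fun z hz => ?_) (hΘ.isRealAnalyticAt hx) (eventually_eq_schwarzExtension Θ x)
    (hΘ.deriv_re_pos hx)).trans_eq ((hΘ.isRealAnalyticAt hx).iteratedDeriv_re 3).symm
  have h := hΘ.re_mem z hz
  exact abs_le.mpr ⟨h.1, h.2.trans Real.pi_pos.le⟩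

theorem IsMarchenkoOstrovski.discriminant_eq_cos (hΘ : IsMarchenkoOstrovski V p Θ)
    (hx : x ∈ interior (spectralSet hp hV)) :
    (discriminant V p x).re = 2 * Real.cos (p * boundaryValue Θ x) := by
  have hg := hΘ.isRealAnalyticAt hx
  have := nhdsWithin_upperHalf_neBot x
  have h1 : Tendsto (discriminant V p) (𝓝[upperHalf] (x : ℂ)) (𝓝 (discriminant V p x)) :=
    ((differentiable_discriminant V p).continuous.tendsto _).mono_left nhdsWithin_le_nhds
  have h2 : Tendsto (fun z => 2 * Complex.cos (p * schwarzExtension Θ z)) (𝓝[upperHalf] (x : ℂ))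
      (𝓝 (2 * Complex.cos (p * schwarzExtension Θ x))) := by
    refine ((Complex.continuous_cos.tendsto _).comp (Tendsto.const_mul _ ?_)).const_mul _
    exact hg.analyticAt.continuousAt.tendsto.mono_left nhdsWithin_le_nhds
  have h3 := tendsto_nhds_unique (h1.congr' (by
    filter_upwards [eventually_eq_schwarzExtension Θ x, self_mem_nhdsWithin] with z h3 h4
    rw [hΘ.discriminant_eq z h4, h3])) h2
  rw [h3, ← hg.ofReal_re]
  have h4 : 2 * Complex.cos (p * ((schwarzExtension Θ x).re : ℂ)) =
      ((2 * Real.cos (p * (schwarzExtension Θ x).re) : ℝ) : ℂ) := by push_cast; rfl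
  rw [h4, Complex.ofReal_re, boundaryValue]

/-- The function `4 - Δ ^ 2` on the real line. -/
def realFourSubSq (V : ℤ → ℝ) (p : ℕ) (x : ℝ) : ℝ := (4 - discriminant V p x ^ 2).re

theorem hasDerivAt_iteratedDeriv_realFourSubSq (V : ℤ → ℝ) (p : ℕ) (x : ℝ) (n : ℕ) :
    HasDerivAt (iteratedDeriv n (realFourSubSq V p)) (iteratedDeriv (n + 1) (realFourSubSq V p) x)
      x :=
  (isRealAnalyticAt_four_sub_sq V p x).hasDerivAt_iteratedDeriv_re n

theorem continuous_iteratedDeriv_realFourSubSq (V : ℤ → ℝ) (p : ℕ) (n : ℕ) :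
    Continuous (iteratedDeriv n (realFourSubSq V p)) :=
  continuous_iff_continuousAt.mpr fun x =>
    (hasDerivAt_iteratedDeriv_realFourSubSq V p x n).continuousAt

theorem continuous_realFourSubSq (V : ℤ → ℝ) (p : ℕ) : Continuous (realFourSubSq V p) := by
  simpa using continuous_iteratedDeriv_realFourSubSq V p 0

theorem mem_spectralSet_iff_realFourSubSq :
    x ∈ spectralSet hp hV ↔ 0 ≤ realFourSubSq V p x := by
  rw [mem_spectralSet_iff_nonneg, realFourSubSq, four_sub_sq_re]

theorem IsMarchenkoOstrovski.realFourSubSq_eq (hΘ : IsMarchenkoOstrovski V p Θ)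
    (hx : x ∈ interior (spectralSet hp hV)) :
    realFourSubSq V p x = 4 * Real.sin (p * boundaryValue Θ x) ^ 2 := by
  rw [realFourSubSq, four_sub_sq_re, hΘ.discriminant_eq_cos hx, Real.sin_sq]
  ring

theorem IsMarchenkoOstrovski.hasDerivAt_boundaryValue (hΘ : IsMarchenkoOstrovski V p Θ)
    (hx : x ∈ interior (spectralSet hp hV)) :
    HasDerivAt (boundaryValue Θ) (deriv (boundaryValue Θ) x) x := by
  simpa using hΘ.hasDerivAt_iteratedDeriv hx 0

theorem IsMarchenkoOstrovski.hasDerivAt_deriv_boundaryValue (hΘ : IsMarchenkoOstrovski V p Θ)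
    (hx : x ∈ interior (spectralSet hp hV)) :
    HasDerivAt (deriv (boundaryValue Θ)) (iteratedDeriv 2 (boundaryValue Θ) x) x := by
  simpa using hΘ.hasDerivAt_iteratedDeriv hx 1

theorem IsMarchenkoOstrovski.deriv_realFourSubSq (hΘ : IsMarchenkoOstrovski V p Θ)
    (hx : x ∈ interior (spectralSet hp hV)) :
    deriv (realFourSubSq V p) x =
      4 * p * deriv (boundaryValue Θ) x * Real.sin (2 * (p * boundaryValue Θ x)) := by
  have h1 : realFourSubSq V p =ᶠ[𝓝 x] fun y => 4 * Real.sin (p * boundaryValue Θ y) ^ 2 := by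
    filter_upwards [isOpen_interior.mem_nhds hx] with y hy using hΘ.realFourSubSq_eq hy
  have h2 := (((((hΘ.hasDerivAt_boundaryValue hx).const_mul (p : ℝ)).sin).pow 2).const_mul 4)
  rw [h1.deriv_eq]
  refine h2.deriv.trans ?_
  rw [Real.sin_two_mul]
  simp
  ring

theorem IsMarchenkoOstrovski.iteratedDeriv_two_realFourSubSq (hΘ : IsMarchenkoOstrovski V p Θ)
    (hx : x ∈ interior (spectralSet hp hV)) :
    iteratedDeriv 2 (realFourSubSq V p) x =
      8 * p ^ 2 * deriv (boundaryValue Θ) x ^ 2 * Real.cos (2 * (p * boundaryValue Θ x)) +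
        4 * p * iteratedDeriv 2 (boundaryValue Θ) x * Real.sin (2 * (p * boundaryValue Θ x)) := by
  have h1 : deriv (realFourSubSq V p) =ᶠ[𝓝 x] fun y =>
      4 * p * deriv (boundaryValue Θ) y * Real.sin (2 * (p * boundaryValue Θ y)) := by
    filter_upwards [isOpen_interior.mem_nhds hx] with y hy using hΘ.deriv_realFourSubSq hy
  have h2 := ((hΘ.hasDerivAt_deriv_boundaryValue hx).const_mul (4 * (p : ℝ))).mul
    (((hΘ.hasDerivAt_boundaryValue hx).const_mul (p : ℝ)).const_mul 2).sin
  rw [iteratedDeriv_succ, iteratedDeriv_one, h1.deriv_eq]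
  refine h2.deriv.trans ?_
  ring

/-! ### Band edges -/

/-- If the second derivative of the Marchenko–Ostrovski map stays bounded near a point of the
spectrum, then that point is interior. -/
theorem IsMarchenkoOstrovski.mem_interior_of_bounded (hΘ : IsMarchenkoOstrovski V p Θ)
    {s t c K : ℝ} (hst : s < t) (hI : Ioo s t ⊆ interior (spectralSet hp hV))
    (hK : ∀ y ∈ Ioo s t, |iteratedDeriv 2 (boundaryValue Θ) y| ≤ K)
    (hc : c ∈ spectralSet hp hV) {l : Filter ℝ} [l.NeBot] (hl : l ≤ 𝓝 c) (hlI : Ioo s t ∈ l) :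
    c ∈ interior (spectralSet hp hV) := by
  by_contra hcI
  set q := realFourSubSq V p with hq
  set f := boundaryValue Θ with hf
  have hqc : q c = 0 := by
    refine le_antisymm (not_lt.mp fun h => hcI ?_) (mem_spectralSet_iff_realFourSubSq.mp hc)
    rw [mem_interior_iff_mem_nhds]
    filter_upwards [(continuous_realFourSubSq V p).continuousAt.eventually (lt_mem_nhds h)]
      with y hy
    exact mem_spectralSet_iff_realFourSubSq.mpr hy.le
  have hpR : (0 : ℝ) < p := by exact_mod_cast hp
  obtain ⟨M, hM⟩ : ∃ M, ∀ y ∈ Ioo s t, |deriv f y| ≤ M := by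
    obtain ⟨m, hm⟩ := nonempty_Ioo.mpr hst
    refine ⟨|deriv f m| + K * (t - s), fun y hy => ?_⟩
    have h1 := (convex_Ioo s t).norm_image_sub_le_of_norm_deriv_le (f := deriv f) (C := K)
      (fun y hy => (hΘ.hasDerivAt_deriv_boundaryValue (hI hy)).differentiableAt)
      (fun y hy => by
        rw [(hΘ.hasDerivAt_deriv_boundaryValue (hI hy)).deriv]
        exact hK y hy) hm hy
    rw [Real.norm_eq_abs, Real.norm_eq_abs] at h1
    have h2 : |y - m| ≤ t - s := abs_le.mpr ⟨by linarith [hy.1, hm.2], by linarith [hy.2, hm.1]⟩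
    have h3 : 0 ≤ K := (abs_nonneg _).trans (hK y hy)
    have h4 := abs_sub_abs_le_abs_sub (deriv f y) (deriv f m)
    nlinarith
  -- Julia's lemma at the fixed point `s + i` bounds the boundary derivative below uniformly on the
  -- interval. This makes the second derivative of `q` at `c` strictly positive.
  obtain ⟨d, hd0, hd⟩ : ∃ d, 0 < d ∧ ∀ y ∈ Ioo s t, d ≤ deriv f y := by
    have hz : (s : ℂ) + I ∈ upperHalf := by simp [upperHalf]
    have hΘz : 0 < (Θ (s + I)).im := hΘ.mapsTo hz
    refine ⟨(Θ (s + I)).im / ((t - s) ^ 2 + 1), by positivity, fun y hy => ?_⟩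
    refine le_trans ?_ (hΘ.le_deriv_boundaryValue (hI hy) hz)
    have h1 : ((s : ℂ) + I).im = 1 := by simp
    have h2 : normSq ((s : ℂ) + I - y) = (s - y) ^ 2 + 1 := by
      rw [Complex.normSq_apply]
      simp
      ring
    rw [h1, h2, one_mul]
    have h3 : (s - y) ^ 2 ≤ (t - s) ^ 2 := by nlinarith [hy.1, hy.2]
    gcongr
  have hsin : Tendsto (fun y => Real.sin (p * f y)) l (𝓝 0) := by
    have h1 : Tendsto q l (𝓝 0) := by
      rw [← hqc]
      exact ((continuous_realFourSubSq V p).tendsto c).mono_left hl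
    have h2 : Tendsto (fun y => Real.sin (p * f y) ^ 2) l (𝓝 0) := by
      have := h1.div_const 4
      rw [zero_div] at this
      refine this.congr' ?_
      filter_upwards [hlI] with y hy
      rw [hq, hΘ.realFourSubSq_eq (hI hy)]
      ring
    have h3 := h2.sqrt
    simp only [Real.sqrt_sq_eq_abs, Real.sqrt_zero] at h3
    exact (tendsto_zero_iff_abs_tendsto_zero _).mpr h3
  have hsin2 : Tendsto (fun y => Real.sin (2 * (p * f y))) l (𝓝 0) := by
    refine squeeze_zero_norm (a := fun y => 2 * |Real.sin (p * f y)|) (fun y => ?_) ?_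
    · rw [Real.norm_eq_abs, Real.sin_two_mul, abs_mul, abs_mul, abs_two]
      exact mul_le_of_le_one_right (by positivity) (Real.abs_cos_le_one _)
    · simpa using hsin.abs.const_mul 2
  have hcos2 : Tendsto (fun y => Real.cos (2 * (p * f y))) l (𝓝 1) := by
    have h := ((hsin.pow 2).const_mul 2).const_sub 1
    norm_num at h
    refine h.congr fun y => ?_
    rw [Real.cos_two_mul, Real.sin_sq]
    ring
  have hbdd_mul {u v : ℝ → ℝ} {B : ℝ} (hu : ∀ y ∈ Ioo s t, |u y| ≤ B) (hv : Tendsto v l (𝓝 0)) :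
      Tendsto (fun y => u y * v y) l (𝓝 0) := by
    refine squeeze_zero_norm' (a := fun y => B * |v y|) ?_ (by simpa using hv.abs.const_mul B)
    filter_upwards [hlI] with y hy
    rw [norm_mul]
    exact mul_le_mul_of_nonneg_right (hu y hy) (abs_nonneg _)
  have hq1 : deriv q c = 0 := by
    have h1 : Tendsto (deriv q) l (𝓝 (deriv q c)) := by
      have := continuous_iteratedDeriv_realFourSubSq V p 1
      rw [iteratedDeriv_one] at this
      exact (this.tendsto c).mono_left hl
    have h2 := (hbdd_mul hM hsin2).const_mul (4 * (p : ℝ))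
    rw [mul_zero] at h2
    refine tendsto_nhds_unique h1 (h2.congr' ?_)
    filter_upwards [hlI] with y hy
    rw [hq, hΘ.deriv_realFourSubSq (hI hy)]
    ring
  have hq2 : 0 < deriv (deriv q) c := by
    have h1 : Tendsto (deriv (deriv q)) l (𝓝 (deriv (deriv q) c)) := by
      have := continuous_iteratedDeriv_realFourSubSq V p 2
      rw [iteratedDeriv_succ, iteratedDeriv_one] at this
      exact (this.tendsto c).mono_left hl
    have h2 : Tendsto (fun y => 8 * p ^ 2 * d ^ 2 * Real.cos (2 * (p * f y)) +
        4 * p * (iteratedDeriv 2 f y * Real.sin (2 * (p * f y)))) l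
        (𝓝 (8 * p ^ 2 * d ^ 2 * 1 + 4 * p * 0)) :=
      (hcos2.const_mul _).add ((hbdd_mul hK hsin2).const_mul _)
    refine lt_of_lt_of_le (by positivity : (0 : ℝ) < 8 * p ^ 2 * d ^ 2 * 1 + 4 * p * 0)
      (le_of_tendsto_of_tendsto h2 h1 ?_)
    filter_upwards [hlI, hcos2.eventually (lt_mem_nhds one_pos)] with y hy hy0
    have h3 := hΘ.iteratedDeriv_two_realFourSubSq (hI hy)
    rw [iteratedDeriv_succ, iteratedDeriv_one] at h3
    rw [h3, mul_assoc (4 * (p : ℝ))]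
    have h4 := hd y hy
    gcongr
  refine hcI (mem_interior_iff_mem_nhds.mpr ?_)
  filter_upwards [isLocalMin_of_deriv_deriv_pos hq2 hq1 (continuous_realFourSubSq V p).continuousAt]
    with y hy
  exact mem_spectralSet_iff_realFourSubSq.mpr (hqc.ge.trans hy)

theorem IsMarchenkoOstrovski.strictMonoOn_iteratedDeriv_two (hΘ : IsMarchenkoOstrovski V p Θ)
    {a b : ℝ} (hI : Ioo a b ⊆ interior (spectralSet hp hV)) :
    StrictMonoOn (iteratedDeriv 2 (boundaryValue Θ)) (Ioo a b) := by
  refine strictMonoOn_of_deriv_pos (convex_Ioo a b) (fun y hy =>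
    (hΘ.hasDerivAt_iteratedDeriv (hI hy) 2).continuousAt.continuousWithinAt) fun y hy => ?_
  rw [interior_Ioo] at hy
  rw [(hΘ.hasDerivAt_iteratedDeriv (hI hy) 2).deriv]
  exact hΘ.iteratedDeriv_three_pos (hI hy)

/-- As the second derivative is increasing, failure to tend to `-∞` bounds it below near `a`, and
monotonicity bounds it above on `(a, m)`. The edge would then be interior. -/
theorem IsMarchenkoOstrovski.tendsto_left_edge (hΘ : IsMarchenkoOstrovski V p Θ) {a b : ℝ}
    (hab : a < b) (hI : Ioo a b ⊆ interior (spectralSet hp hV)) (ha : a ∈ spectralSet hp hV)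
    (haI : a ∉ interior (spectralSet hp hV)) :
    Tendsto (iteratedDeriv 2 (boundaryValue Θ)) (𝓝[>] a) atBot := by
  have hmono := hΘ.strictMonoOn_iteratedDeriv_two hI
  refine tendsto_atBot.mpr fun M => ?_
  by_contra hM
  have hfreq : ∃ᶠ y in 𝓝[>] a, M < iteratedDeriv 2 (boundaryValue Θ) y :=
    (not_eventually.mp hM).mono fun y hy => not_le.mp hy
  obtain ⟨m, hm⟩ := nonempty_Ioo.mpr hab
  refine haI (hΘ.mem_interior_of_bounded (s := a) (t := m)
    (K := max |M| |iteratedDeriv 2 (boundaryValue Θ) m|) hm.1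
    ((Ioo_subset_Ioo_right hm.2.le).trans hI) (fun y hy => ?_) ha (l := 𝓝[>] a)
    nhdsWithin_le_nhds (Ioo_mem_nhdsGT hm.1))
  obtain ⟨w, hw, hwy⟩ := (hfreq.and_eventually (Ioo_mem_nhdsGT hy.1)).exists
  have hyI : y ∈ Ioo a b := ⟨hy.1, hy.2.trans hm.2⟩
  refine abs_le_max_abs_abs ?_ (hmono hyI hm hy.2).le
  exact hw.le.trans (hmono ⟨hwy.1, hwy.2.trans hyI.2⟩ hyI hwy.2).le

theorem IsMarchenkoOstrovski.tendsto_right_edge (hΘ : IsMarchenkoOstrovski V p Θ) {a b : ℝ}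
    (hab : a < b) (hI : Ioo a b ⊆ interior (spectralSet hp hV)) (hb : b ∈ spectralSet hp hV)
    (hbI : b ∉ interior (spectralSet hp hV)) :
    Tendsto (iteratedDeriv 2 (boundaryValue Θ)) (𝓝[<] b) atTop := by
  have hmono := hΘ.strictMonoOn_iteratedDeriv_two hI
  refine tendsto_atTop.mpr fun M => ?_
  by_contra hM
  have hfreq : ∃ᶠ y in 𝓝[<] b, iteratedDeriv 2 (boundaryValue Θ) y < M :=
    (not_eventually.mp hM).mono fun y hy => not_le.mp hy
  obtain ⟨m, hm⟩ := nonempty_Ioo.mpr hab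
  refine hbI (hΘ.mem_interior_of_bounded (s := m) (t := b)
    (K := max |iteratedDeriv 2 (boundaryValue Θ) m| |M|) hm.2
    ((Ioo_subset_Ioo_left hm.1.le).trans hI) (fun y hy => ?_) hb (l := 𝓝[<] b)
    nhdsWithin_le_nhds (Ioo_mem_nhdsLT hm.2))
  obtain ⟨w, hw, hwy⟩ := (hfreq.and_eventually (Ioo_mem_nhdsLT hy.2)).exists
  have hyI : y ∈ Ioo a b := ⟨hm.1.trans hy.1, hy.2⟩
  refine abs_le_max_abs_abs (hmono hm hyI hy.1).le ?_
  exact (hmono hyI ⟨hyI.1.trans hwy.1, hwy.2⟩ hwy.1).le.trans hw.le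

/-! ### Connected components of the spectrum -/

theorem isCompact_spectralSet (hp : 0 < p) (hV : Function.Periodic V (p : ℤ)) :
    IsCompact (spectralSet hp hV) :=
  Complex.isometry_ofReal.isClosedEmbedding.isCompact_preimage (spectrum.isCompact _)

/-- By the open mapping theorem `Δ` attains near `x` some other value of `[-2, 2]`. It does so at a
real point, since neither open half-plane is mapped into that segment. -/
theorem frequently_mem_spectralSet (hx : x ∈ spectralSet hp hV) :
    ∃ᶠ y in 𝓝[≠] x, y ∈ spectralSet hp hV := by
  intro hev
  have hxD := (mem_spectralSet_iff hp hV x).mp hx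
  set D := (discriminant V p x).re with hD
  have hDx : discriminant V p x = D := discriminant_ofReal V p x
  obtain ⟨r, hr, hball⟩ := Metric.eventually_nhds_iff_ball.mp (eventually_nhdsWithin_iff.mp hev)
  have hopen := ((differentiable_discriminant V p).analyticAt
    (x : ℂ)).eventually_constant_or_nhds_le_map_nhds.resolve_left
    (by rw [hDx]; exact discriminant_not_locally_const hp hV hxD x)
  have himg : discriminant V p '' Metric.ball (x : ℂ) r ∈ 𝓝 (D : ℂ) := by
    rw [← hDx]
    exact hopen (image_mem_map (Metric.ball_mem_nhds _ hr))
  obtain ⟨δ, hδ, hδimg⟩ := Metric.mem_nhds_iff.mp himg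
  -- Moving from `D` towards the opposite sign by at most 1 stays inside `[-2, 2]`.
  obtain ⟨t, ht2, htD, htδ⟩ : ∃ t : ℝ, |t| ≤ 2 ∧ t ≠ D ∧ |t - D| < δ := by
    have h1 := abs_le.mp hxD
    set η := min (δ / 2) 1 with hη
    have hη0 : 0 < η := lt_min (by linarith) one_pos
    have hη1 : η ≤ 1 := min_le_right _ _
    have hηδ : η < δ := (min_le_left _ _).trans_lt (by linarith)
    rcases le_total D 0 with h | h
    · refine ⟨D + η, abs_le.mpr ⟨by linarith, by linarith⟩, by linarith, ?_⟩
      rwa [add_sub_cancel_left, abs_of_pos hη0]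
    · refine ⟨D - η, abs_le.mpr ⟨by linarith, by linarith⟩, by linarith, ?_⟩
      rwa [sub_sub_cancel_left, abs_neg, abs_of_pos hη0]
  obtain ⟨z, hz, hzt⟩ := hδimg (show (t : ℂ) ∈ Metric.ball (D : ℂ) δ by
    rwa [Metric.mem_ball, dist_eq_norm, ← Complex.ofReal_sub, Complex.norm_real])
  have him : z.im = 0 := by
    rcases lt_trichotomy z.im 0 with h | h | h
    · refine absurd ?_ (discriminant_not_mem hV hp (z := conj z) (by simpa using h) ht2)
      rw [← conj_discriminant, hzt, Complex.conj_ofReal]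
    · exact h
    · exact absurd hzt (discriminant_not_mem hV hp h ht2)
  obtain ⟨y, rfl⟩ : ∃ y : ℝ, z = y := ⟨z.re, Complex.ext rfl him⟩
  have hyx : y ≠ x := by
    rintro rfl
    rw [hDx] at hzt
    exact htD (by exact_mod_cast hzt.symm)
  refine hball y ?_ hyx ((mem_spectralSet_iff hp hV y).mpr (by rwa [hzt, Complex.ofReal_re]))
  rwa [Metric.mem_ball, dist_eq_norm, ← Complex.ofReal_sub, Complex.norm_real] at hz

theorem eventually_realFourSubSq_ne_zero (hp : 0 < p) (hV : Function.Periodic V (p : ℤ)) (x : ℝ) :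
    ∀ᶠ y in 𝓝[≠] x, realFourSubSq V p y ≠ 0 := by
  have h := (isRealAnalyticAt_four_sub_sq V p x).analyticAt.eventually_eq_zero_or_eventually_ne_zero
    |>.resolve_left (four_sub_discriminant_sq_not_locally_zero hp hV x)
  have ht : Tendsto ((↑) : ℝ → ℂ) (𝓝[≠] x) (𝓝[≠] (x : ℂ)) :=
    tendsto_nhdsWithin_iff.mpr ⟨Complex.continuous_ofReal.continuousAt.mono_left
      nhdsWithin_le_nhds, eventually_mem_nhdsWithin.mono fun y hy => by
        simpa using hy⟩
  filter_upwards [ht.eventually h] with y hy h0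
  exact hy (by rw [← (isRealAnalyticAt_four_sub_sq V p y).ofReal_re]; exact_mod_cast h0)

/-- Leaving the spectrum between `u` and `w` would make `4 - Δ²` negative, and its return to a
nonnegative value at `w` would create a forbidden zero. -/
theorem uIcc_subset_spectralSet {u w : ℝ} (hu : u ∈ spectralSet hp hV) (hw : w ∈ spectralSet hp hV)
    (h : ∀ y ∈ uIcc u w, y ≠ u → realFourSubSq V p y ≠ 0) : uIcc u w ⊆ spectralSet hp hV := by
  intro y hy
  by_contra hyS
  rw [mem_spectralSet_iff_realFourSubSq, not_le] at hyS
  have hw0 := mem_spectralSet_iff_realFourSubSq.mp hw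
  obtain ⟨c, hc, hc0⟩ := intermediate_value_uIcc
    ((continuous_realFourSubSq V p).continuousOn (s := uIcc y w))
    (mem_uIcc_of_le hyS.le hw0)
  have hyu : y ≠ u := by
    rintro rfl
    exact absurd (mem_spectralSet_iff_realFourSubSq.mp hu) (not_le.mpr hyS)
  refine h c (uIcc_subset_uIcc hy right_mem_uIcc hc) ?_ hc0
  rintro rfl
  rw [mem_uIcc] at hy hc
  exact hyu (by rcases hy with h1 | h1 <;> rcases hc with h2 | h2 <;>
    linarith [h1.1, h1.2, h2.1, h2.2])

theorem exists_uIcc_subset_spectralSet (hx : x ∈ spectralSet hp hV) :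
    ∃ w, w ≠ x ∧ uIcc x w ⊆ spectralSet hp hV := by
  obtain ⟨r, hr, hball⟩ := Metric.eventually_nhds_iff_ball.mp
    (eventually_nhdsWithin_iff.mp (eventually_realFourSubSq_ne_zero hp hV x))
  obtain ⟨w, hw, hwr, hwx⟩ := ((frequently_mem_spectralSet hx).and_eventually
    (inter_mem (nhdsWithin_le_nhds (Metric.ball_mem_nhds x hr)) self_mem_nhdsWithin)).exists
  refine ⟨w, hwx, uIcc_subset_spectralSet hx hw fun y hy hyx => hball y ?_ hyx⟩
  exact (convex_ball x r).ordConnected.uIcc_subset (Metric.mem_ball_self hr) hwr hy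

theorem exists_component_eq_Icc (hx : x ∈ spectralSet hp hV) :
    ∃ a b : ℝ, a < b ∧ connectedComponentIn (spectralSet hp hV) x = Icc a b ∧
      a ∈ spectralSet hp hV ∧ b ∈ spectralSet hp hV ∧ a ∉ interior (spectralSet hp hV) ∧
      b ∉ interior (spectralSet hp hV) ∧ Ioo a b ⊆ interior (spectralSet hp hV) := by
  set S := spectralSet hp hV
  have hS : IsCompact S := isCompact_spectralSet hp hV
  have hC : IsCompact (connectedComponentIn S x) :=
    hS.of_isClosed_subset (isClosed_of_closure_subset
      (isPreconnected_connectedComponentIn.closure.subset_connectedComponentIn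
        (subset_closure (mem_connectedComponentIn hx))
        (closure_minimal (connectedComponentIn_subset S x) hS.isClosed)))
      (connectedComponentIn_subset S x)
  have hCeq := eq_Icc_of_connected_compact (isConnected_connectedComponentIn_iff.mpr hx) hC
  set a := sInf (connectedComponentIn S x)
  set b := sSup (connectedComponentIn S x)
  -- The component absorbs every interval of the spectrum that touches it. This gives both its
  -- positive length and the fact that its endpoints are not interior.
  have hmax {u w : ℝ} (hu : u ∈ Icc a b) (huw : uIcc u w ⊆ S) : w ∈ Icc a b := by
    rw [← hCeq] at hu ⊢
    rw [connectedComponentIn_eq hu]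
    exact isPreconnected_uIcc.subset_connectedComponentIn left_mem_uIcc huw right_mem_uIcc
  have hxab : x ∈ Icc a b := hCeq ▸ mem_connectedComponentIn hx
  have hIccS : Icc a b ⊆ S := hCeq ▸ connectedComponentIn_subset S x
  have hab : a < b := by
    obtain ⟨w, hwx, hw⟩ := exists_uIcc_subset_spectralSet hx
    have hwab := hmax hxab hw
    refine lt_of_le_of_ne (hxab.1.trans hxab.2) fun h => hwx ?_
    rw [← h, Icc_self, mem_singleton_iff] at hwab hxab
    rw [hwab, hxab]
  have hball {y : ℝ} (hy : y ∈ interior S) : ∃ r > 0, uIcc y (y - r) ⊆ S ∧ uIcc y (y + r) ⊆ S := by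
    obtain ⟨r, hr, h⟩ := Metric.nhds_basis_closedBall.mem_iff.mp (mem_interior_iff_mem_nhds.mp hy)
    rw [Real.closedBall_eq_Icc] at h
    refine ⟨r, hr, ?_, ?_⟩
    · rw [uIcc_of_ge (by linarith)]
      exact (Icc_subset_Icc_right (by linarith)).trans h
    · rw [uIcc_of_le (by linarith)]
      exact (Icc_subset_Icc_left (by linarith)).trans h
  refine ⟨a, b, hab, hCeq, hIccS (left_mem_Icc.mpr hab.le), hIccS (right_mem_Icc.mpr hab.le),
    fun h => ?_, fun h => ?_, interior_maximal (Ioo_subset_Icc_self.trans hIccS) isOpen_Ioo⟩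
  · obtain ⟨r, hr, h1, -⟩ := hball h
    linarith [(hmax (left_mem_Icc.mpr hab.le) h1).1]
  · obtain ⟨r, hr, -, h1⟩ := hball h
    linarith [(hmax (right_mem_Icc.mpr hab.le) h1).2]

theorem exists_component_interior_eq_Ioo (hx : x ∈ interior (spectralSet hp hV)) :
    ∃ a b : ℝ, a < b ∧ connectedComponentIn (interior (spectralSet hp hV)) x = Ioo a b ∧
      a ∈ spectralSet hp hV ∧ b ∈ spectralSet hp hV ∧ a ∉ interior (spectralSet hp hV) ∧
      b ∉ interior (spectralSet hp hV) ∧ Ioo a b ⊆ interior (spectralSet hp hV) := by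
  obtain ⟨a, b, hab, hC, ha, hb, haI, hbI, hI⟩ := exists_component_eq_Icc (interior_subset hx)
  have hopen {y : ℝ} (hy : y ∈ interior (spectralSet hp hV)) (hyC : y ∈ Icc a b) : y ∈ Ioo a b :=
    ⟨lt_of_le_of_ne hyC.1 (by rintro rfl; exact haI hy),
      lt_of_le_of_ne hyC.2 (by rintro rfl; exact hbI hy)⟩
  refine ⟨a, b, hab, Subset.antisymm (fun y hy => ?_) ?_, ha, hb, haI, hbI, hI⟩
  · refine hopen (connectedComponentIn_subset _ _ hy) ?_
    rw [← hC]
    exact connectedComponentIn_mono x interior_subset hy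
  · exact isPreconnected_Ioo.subset_connectedComponentIn
      (hopen hx (hC ▸ mem_connectedComponentIn (interior_subset hx))) hI

end Boundary

end PeriodicSchrodinger

end

open PeriodicSchrodinger in
theorem lemma2p1 (p : ℕ) (hp : 0 < p) (V : ℤ → ℝ) (hV : Function.Periodic V (p : ℤ)) :
    (∃ Θ : ℂ → ℂ, IsMarchenkoOstrovski V p Θ) ∧
    ∀ Θ : ℂ → ℂ, IsMarchenkoOstrovski V p Θ →
      -- the extension through the interior of the spectrum is analytic, real, and has
      -- positive first and third derivatives
      (∀ x ∈ interior (spectralSet hp hV),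
        AnalyticAt ℂ (schwarzExtension Θ) (x : ℂ) ∧
        (schwarzExtension Θ x).im = 0 ∧
        0 < deriv (boundaryValue Θ) x ∧
        0 < iteratedDeriv 3 (boundaryValue Θ) x) ∧
      -- each connected component of the spectrum is a nondegenerate compact interval, with
      -- the stated limits of the second derivative at its edges
      (∀ x ∈ spectralSet hp hV, ∃ a b : ℝ, a < b ∧
        connectedComponentIn (spectralSet hp hV) x = Icc a b ∧
        Tendsto (iteratedDeriv 2 (boundaryValue Θ)) (𝓝[>] a) atBot ∧
        Tendsto (iteratedDeriv 2 (boundaryValue Θ)) (𝓝[<] b) atTop) ∧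
      -- each connected component of the interior contains a unique zero of the second derivative,
      -- and the third derivative does not vanish there
      (∀ x ∈ interior (spectralSet hp hV),
        (∃! y : ℝ, y ∈ connectedComponentIn (interior (spectralSet hp hV)) x ∧
          iteratedDeriv 2 (boundaryValue Θ) y = 0) ∧
        ∀ y ∈ connectedComponentIn (interior (spectralSet hp hV)) x,
          iteratedDeriv 2 (boundaryValue Θ) y = 0 →
            iteratedDeriv 3 (boundaryValue Θ) y ≠ 0) := by
  refine ⟨exists_isMarchenkoOstrovski hV hp, fun Θ hΘ => ⟨fun x hx => ?_, fun x hx => ?_,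
    fun x hx => ⟨?_, fun y hy _ =>
      (hΘ.iteratedDeriv_three_pos (connectedComponentIn_subset _ _ hy)).ne'⟩⟩⟩
  · exact ⟨(hΘ.isRealAnalyticAt hx).analyticAt, (hΘ.isRealAnalyticAt hx).im_self,
      hΘ.deriv_boundaryValue_pos hx, hΘ.iteratedDeriv_three_pos hx⟩
  · obtain ⟨a, b, hab, hC, ha, hb, haI, hbI, hI⟩ := exists_component_eq_Icc hx
    exact ⟨a, b, hab, hC, hΘ.tendsto_left_edge hab hI ha haI, hΘ.tendsto_right_edge hab hI hb hbI⟩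
  · obtain ⟨a, b, hab, hC, ha, hb, haI, hbI, hI⟩ := exists_component_interior_eq_Ioo hx
    rw [hC]
    have hmono := hΘ.strictMonoOn_iteratedDeriv_two hI
    -- The edge limits supply points with negative and positive second derivative, and strict
    -- monotonicity orders them for the intermediate value theorem.
    obtain ⟨u, hu0, hu⟩ := (((hΘ.tendsto_left_edge hab hI ha haI).eventually_lt_atBot 0).and
      (Ioo_mem_nhdsGT hab)).exists
    obtain ⟨w, hw0, hw⟩ := (((hΘ.tendsto_right_edge hab hI hb hbI).eventually_gt_atTop 0).and
      (Ioo_mem_nhdsLT hab)).exists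
    have huw : u < w := (hmono.lt_iff_lt hu hw).mp (hu0.trans hw0)
    have hsub : Icc u w ⊆ Ioo a b := Icc_subset_Ioo hu.1 hw.2
    obtain ⟨y, hy, hy0⟩ := intermediate_value_Icc huw.le (fun y hy =>
      (hΘ.hasDerivAt_iteratedDeriv (hI (hsub hy)) 2).continuousAt.continuousWithinAt)
      ⟨hu0.le, hw0.le⟩
    exact ⟨y, ⟨hsub hy, hy0⟩, fun y' hy' => hmono.injOn hy'.1 (hsub hy) (hy'.2.trans hy0.symm)⟩
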